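/- Let $k$ be a field and let $A$ be a connected cochain DG $k$-algebra: a $\mathbb{Z}$-graded $k$-algebra with $A^i=0$ for $i<0$ and $A^0=k$, together with a $k$-linear differential $\partial_A$ of degree $1$, with $\partial_A^2=0$ and $\partial_A(ab)=\partial_A(a)b+(-1)^{|a|}a\,\partial_A(b)$. Put $\mathfrak{m}=\bigoplus_{i\ge 1}A^i$. Assume that the cohomology algebra $H(A)$ is left Noetherian (in particular, this holds if $H(A)$ is Noetherian). All modules are left modules. A DG $A$-module is DG free if it is isomorphic to a direct sum of suspensions of $A$. A semi-free filtration of a DG $A$-module $G$ is a chain of DG submodules $0=G(-1)\subseteq G(0)\subseteq G(1)\subseteq\cdots$ with union $G$ such that every $G(n)/G(n-1)$ is DG free; it is strictly increasing if $G(n)\ne G(n-1)$ whenever $n\ge 0$ and $G(n-1)\neq G$, and its length is the least $n\ge 0$ with $G(n)=G$ (and $\infty$ if there is no such $n$). $G$ is semi-free if it has a semi-free filtration, and its DG free class is the smallest length of a strictly increasing semi-free filtration of $G$. A semi-free $G$ is minimal if $\partial_G(G)\subseteq\mathfrak{m}G$. A semi-basis of $G$ is a set $E$ of homogeneous elements that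 is a basis of $G$ over $A$ (forgetting differentials), with a decomposition $E=\bigsqcup_{u\ge 0}E_u$ such that $\partial_G(E_0)=0$ and $\partial_G(E_u)\subseteq A\bigl(\bigsqcup_{i<u}E_i\bigr)$ for all $u>0$. Let $D(A)$ be the derived category of $A$, obtained from the category of DG $A$-modules by inverting the quasi-isomorphisms; $G$ is compact if the functor $\mathrm{Hom}_{D(A)}(G,-)$ to abelian groups preserves all coproducts. Proposition. Let $G$ be a minimal semi-free DG $A$-module with finite DG free class such that $H(G)$ is a finitely generated $H(A)$-module. Then $G$ has a finite semi-basis, and $G$ is compact. -/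

import Mathlib

open CategoryTheory CategoryTheory.Limits

universe u

/-! ### The additive structure of a localization

If `C` is an additive category and the localization functor `C ⥤ W.Localization` preserves finite
products, then the localized category is preadditive: `f + g` is the composite of
`(f, g) : Z ⟶ Y × Y` with the addition `Y × Y ⟶ Y`. -/

namespace LocAdd

open scoped ZeroObject

variable {C : Type*} [Category C] [Preadditive C] [HasBinaryBiproducts C]
variable {D : Type*} [Category D] (L : C ⥤ D) [PreservesFiniteProducts L]

/-- `L (X ⊞ Y)` is the product of `L X` and `L Y`. -/
noncomputable def isLim (X Y : C) :
    IsLimit (BinaryFan.mk (L.map (biprod.fst : X ⊞ Y ⟶ X)) (L.map (biprod.snd : X ⊞ Y ⟶ Y))) :=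
  mapIsLimitOfPreservesOfIsLimit L _ _ (BinaryBiproduct.isLimit X Y)

/-- The morphism into `L (X ⊞ Y)` with the given components. -/
noncomputable def pair {Z : D} {X Y : C} (f : Z ⟶ L.obj X) (g : Z ⟶ L.obj Y) :
    Z ⟶ L.obj (X ⊞ Y) :=
  BinaryFan.IsLimit.lift (isLim L X Y) f g

lemma pair_fst {Z : D} {X Y : C} (f : Z ⟶ L.obj X) (g : Z ⟶ L.obj Y) :
    pair L f g ≫ L.map biprod.fst = f :=
  BinaryFan.IsLimit.lift_fst (isLim L X Y) f g

lemma pair_snd {Z : D} {X Y : C} (f : Z ⟶ L.obj X) (g : Z ⟶ L.obj Y) :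
    pair L f g ≫ L.map biprod.snd = g :=
  BinaryFan.IsLimit.lift_snd (isLim L X Y) f g

lemma hom_ext {Z : D} {X Y : C} {f g : Z ⟶ L.obj (X ⊞ Y)}
    (h₁ : f ≫ L.map biprod.fst = g ≫ L.map biprod.fst)
    (h₂ : f ≫ L.map biprod.snd = g ≫ L.map biprod.snd) : f = g :=
  BinaryFan.IsLimit.hom_ext (isLim L X Y) h₁ h₂

/-- The sum of two morphisms into `L Y`: pair them, then add the two projections. -/
noncomputable def add {Z : D} {Y : C} (f g : Z ⟶ L.obj Y) : Z ⟶ L.obj Y :=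
  pair L f g ≫ L.map (biprod.fst + biprod.snd)

/-- The opposite of a morphism into `L Y`. -/
noncomputable def neg {Z : D} {Y : C} (f : Z ⟶ L.obj Y) : Z ⟶ L.obj Y :=
  f ≫ L.map (-𝟙 Y)

lemma add_map_map {Z : D} {T Y : C} (t : Z ⟶ L.obj T) (a b : T ⟶ Y) :
    add L (t ≫ L.map a) (t ≫ L.map b) = t ≫ L.map (a + b) := by
  have : pair L (t ≫ L.map a) (t ≫ L.map b) = t ≫ L.map (biprod.lift a b) := by
    apply hom_ext
    · rw [pair_fst, Category.assoc, ← L.map_comp, biprod.lift_fst]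
    · rw [pair_snd, Category.assoc, ← L.map_comp, biprod.lift_snd]
  rw [add, this, Category.assoc, ← L.map_comp, Preadditive.comp_add, biprod.lift_fst,
    biprod.lift_snd]

lemma exists_pair {Z : D} {X Y : C} (f : Z ⟶ L.obj X) (g : Z ⟶ L.obj Y) :
    ∃ (T : C) (t : Z ⟶ L.obj T) (a : T ⟶ X) (b : T ⟶ Y), f = t ≫ L.map a ∧ g = t ≫ L.map b :=
  ⟨_, pair L f g, biprod.fst, biprod.snd, (pair_fst L f g).symm, (pair_snd L f g).symm⟩

lemma assoc' {Z : D} {Y : C} (f g h : Z ⟶ L.obj Y) :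
    add L (add L f g) h = add L f (add L g h) := by
  obtain ⟨T, t, a, b, rfl, rfl⟩ := exists_pair L f g
  obtain ⟨S, s, c, e, rfl, rfl⟩ := exists_pair L t h
  simp only [Category.assoc, ← L.map_comp, add_map_map, add_assoc]

lemma comm' {Z : D} {Y : C} (f g : Z ⟶ L.obj Y) : add L f g = add L g f := by
  obtain ⟨T, t, a, b, rfl, rfl⟩ := exists_pair L f g
  rw [add_map_map, add_map_map, add_comm]

lemma add_comp_map {Z : D} {Y Y' : C} (f g : Z ⟶ L.obj Y) (a : Y ⟶ Y') :
    add L f g ≫ L.map a = add L (f ≫ L.map a) (g ≫ L.map a) := by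
  obtain ⟨T, t, b, c, rfl, rfl⟩ := exists_pair L f g
  simp only [Category.assoc, ← L.map_comp, add_map_map, Preadditive.add_comp]

lemma comp_add' {Z Z' : D} {Y : C} (h : Z' ⟶ Z) (f g : Z ⟶ L.obj Y) :
    h ≫ add L f g = add L (h ≫ f) (h ≫ g) := by
  obtain ⟨T, t, b, c, rfl, rfl⟩ := exists_pair L f g
  rw [add_map_map, ← Category.assoc, ← Category.assoc, ← Category.assoc, add_map_map]

lemma add_comp_inv {Z : D} {X Y : C} (i : L.obj X ≅ L.obj Y)
    (h : ∀ f g : Z ⟶ L.obj X, add L f g ≫ i.hom = add L (f ≫ i.hom) (g ≫ i.hom))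
    (f g : Z ⟶ L.obj Y) : add L f g ≫ i.inv = add L (f ≫ i.inv) (g ≫ i.inv) := by
  have h := h (f ≫ i.inv) (g ≫ i.inv)
  rw [Category.assoc, Category.assoc, i.inv_hom_id, Category.comp_id, Category.comp_id] at h
  rw [← h, Category.assoc, i.hom_inv_id, Category.comp_id]

variable (W : MorphismProperty C) [PreservesFiniteProducts W.Q]

/-- The morphisms of the localized category along which postcomposition is additive. -/
def additiveMor : MorphismProperty W.Localization := fun X Y φ =>
  ∀ (Z : W.Localization) (f g : Z ⟶ W.Q.obj X.as.obj),
    add W.Q f g ≫ (show W.Q.obj X.as.obj ⟶ W.Q.obj Y.as.obj from φ) =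
      add W.Q (f ≫ (show W.Q.obj X.as.obj ⟶ W.Q.obj Y.as.obj from φ))
        (g ≫ (show W.Q.obj X.as.obj ⟶ W.Q.obj Y.as.obj from φ))

lemma additiveMor_eq_top : additiveMor W = ⊤ := by
  have : (additiveMor W).IsStableUnderComposition := ⟨by
    intro X Y Z φ ψ hφ hψ T f g
    have h1 := hφ T f g
    have h2 := hψ T (f ≫ φ) (g ≫ φ)
    have e1 : f ≫ (φ ≫ ψ) = (f ≫ φ) ≫ ψ := (Category.assoc f φ ψ).symm
    have e2 : g ≫ (φ ≫ ψ) = (g ≫ φ) ≫ ψ := (Category.assoc g φ ψ).symm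
    refine Eq.trans ?_ (h2.trans (congrArg₂ (add W.Q) e1.symm e2.symm))
    exact (Category.assoc (add W.Q f g) φ ψ).symm.trans (congrArg (· ≫ ψ) h1)⟩
  refine Localization.Construction.morphismProperty_eq_top _ ?_ ?_
  · intro X Y a Z f g
    exact add_comp_map W.Q f g a
  · intro X Y w hw Z f g
    exact add_comp_inv W.Q (Localization.Construction.wIso w hw)
      (fun f g => add_comp_map W.Q f g w) f g

variable [HasZeroObject C]

/-- The zero morphism into `L Y`, through the terminal object `L 0`. -/
noncomputable def zero (Z : D) (Y : C) : Z ⟶ L.obj Y :=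
  (IsTerminal.isTerminalObj L (0 : C) (isZero_zero C).isTerminal).from Z ≫ L.map 0

lemma comp_map_zero {Z : D} {T Y : C} (t : Z ⟶ L.obj T) :
    t ≫ L.map (0 : T ⟶ Y) = zero L Z Y := by
  have h : (0 : T ⟶ Y) = (0 : T ⟶ (0 : C)) ≫ 0 := by simp
  rw [h, L.map_comp, ← Category.assoc, zero]
  congr 1
  exact (IsTerminal.isTerminalObj L (0 : C) (isZero_zero C).isTerminal).hom_ext _ _

lemma zero_add' {Z : D} {Y : C} (f : Z ⟶ L.obj Y) : add L (zero L Z Y) f = f := by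
  have := add_map_map L f 0 (𝟙 Y)
  rwa [comp_map_zero, zero_add, L.map_id, Category.comp_id] at this

lemma neg_add' {Z : D} {Y : C} (f : Z ⟶ L.obj Y) : add L (neg L f) f = zero L Z Y := by
  have := add_map_map L f (-𝟙 Y) (𝟙 Y)
  rwa [neg_add_cancel, comp_map_zero, L.map_id, Category.comp_id] at this

/-- The group of morphisms into `L Y`. -/
@[reducible]
noncomputable def homGroup (Z : D) (Y : C) : AddCommGroup (Z ⟶ L.obj Y) :=
  letI : Add (Z ⟶ L.obj Y) := ⟨add L⟩
  letI : Zero (Z ⟶ L.obj Y) := ⟨zero L Z Y⟩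
  letI : Neg (Z ⟶ L.obj Y) := ⟨neg L⟩
  { add_assoc := assoc' L
    add_comm := comm' L
    zero_add := zero_add' L
    add_zero := fun f => (comm' L _ _).trans (zero_add' L f)
    neg_add_cancel := neg_add' L
    nsmul := nsmulRec
    zsmul := zsmulRec }

/-- The preadditive structure on the localized category. -/
@[reducible]
noncomputable def preadditive : Preadditive W.Localization where
  homGroup Z Y := homGroup W.Q Z Y.as.obj
  add_comp Z X Y f g φ := by
    have h : additiveMor W φ := by rw [additiveMor_eq_top]; trivial
    exact h Z f g
  comp_add Z' Z Y h f g := comp_add' W.Q (Y := Y.as.obj) h f g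

lemma Q_additive : letI := preadditive W; W.Q.Additive := by
  let _ := preadditive W
  refine ⟨fun {X Y f g} => ?_⟩
  have := add_map_map W.Q (𝟙 (W.Q.obj X)) f g
  rw [Category.id_comp, Category.id_comp, Category.id_comp] at this
  exact this.symm

end LocAdd

/-! ### DG algebras and DG modules -/

/-- A cochain differential graded algebra over the field `k`: a `ℤ`-graded `k`-algebra with a
`k`-linear differential of degree `1`, of square zero, satisfying the graded Leibniz rule. -/
structure DGAlgebra (k : Type u) [Field k] where
  carrier : Type u
  [ring : Ring carrier]
  [algebra : Algebra k carrier]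
  gr : ℤ → Submodule k carrier
  [graded : GradedAlgebra gr]
  d : carrier →ₗ[k] carrier
  d_mem : ∀ {i : ℤ} {a : carrier}, a ∈ gr i → d a ∈ gr (i + 1)
  d_d : ∀ a : carrier, d (d a) = 0
  leibniz : ∀ {i : ℤ} {a : carrier}, a ∈ gr i → ∀ b : carrier,
    d (a * b) = d a * b + i.negOnePow • (a * d b)

attribute [instance] DGAlgebra.ring DGAlgebra.algebra DGAlgebra.graded

section DG

variable {k : Type u} [Field k]

/-- A left DG module over the DG algebra `A`. -/
structure DGModule (A : DGAlgebra k) where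
  carrier : Type u
  [addCommGroup : AddCommGroup carrier]
  [moduleBase : Module k carrier]
  [module : Module A.carrier carrier]
  [tower : IsScalarTower k A.carrier carrier]
  gr : ℤ → Submodule k carrier
  [decomposition : DirectSum.Decomposition gr]
  smul_mem : ∀ {i j : ℤ} {a : A.carrier} {x : carrier}, a ∈ A.gr i → x ∈ gr j → a • x ∈ gr (i + j)
  d : carrier →ₗ[k] carrier
  d_mem : ∀ {i : ℤ} {x : carrier}, x ∈ gr i → d x ∈ gr (i + 1)
  d_d : ∀ x : carrier, d (d x) = 0
  leibniz : ∀ {i : ℤ} {a : A.carrier}, a ∈ A.gr i → ∀ x : carrier,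
    d (a • x) = A.d a • x + i.negOnePow • (a • d x)

attribute [instance] DGModule.addCommGroup DGModule.moduleBase DGModule.module DGModule.tower
  DGModule.decomposition

namespace DGAlgebra

variable (A : DGAlgebra k)

/-- `A` is connected: the underlying graded algebra satisfies `A^i = 0` for `i < 0` and
`A^0 = k`. -/
structure IsConnected : Prop where
  nontrivial : Nontrivial A.carrier
  gr_neg : ∀ i : ℤ, i < 0 → A.gr i = ⊥
  gr_zero : A.gr 0 = Submodule.span k {1}

/-- The subspace `A^1 ⊕ A^2 ⊕ ⋯` (the maximal DG ideal when `A` is connected). -/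
def maxIdeal : Submodule k A.carrier := ⨆ i : {i : ℤ // 0 < i}, A.gr i

/-- `A` as a left DG module over itself. -/
def self : DGModule A where
  carrier := A.carrier
  gr := A.gr
  smul_mem ha hx := SetLike.mul_mem_graded ha hx
  d := A.d
  d_mem := A.d_mem
  d_d := A.d_d
  leibniz := A.leibniz

end DGAlgebra

namespace DGModule

variable {A : DGAlgebra k} (M : DGModule A)

/-- An element is homogeneous if it lies in some graded piece. -/
def IsHomog (x : M.carrier) : Prop := ∃ i : ℤ, x ∈ M.gr i

lemma decompose_d (x : M.carrier) (i : ℤ) :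
    (DirectSum.decompose M.gr (M.d x) (i + 1) : M.carrier) =
      M.d (DirectSum.decompose M.gr x i : M.carrier) := by
  induction x using DirectSum.Decomposition.inductionOn M.gr with
  | zero => simp
  | @homogeneous j x =>
    rw [DirectSum.decompose_coe]
    by_cases h : j = i
    · subst h
      rw [DirectSum.of_eq_same, DirectSum.decompose_of_mem_same _ (M.d_mem x.2)]
    · rw [DirectSum.of_eq_of_ne _ _ _ (Ne.symm h),
        DirectSum.decompose_of_mem_ne _ (M.d_mem x.2) (by omega)]
      simp
  | add x y hx hy => simp only [map_add, DirectSum.decompose_add, DirectSum.add_apply,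
      Submodule.coe_add, hx, hy]

end DGModule

namespace DGAlgebra

variable (A : DGAlgebra k)

lemma d_component {a : A.carrier} (ha : A.d a = 0) (i : ℤ) :
    A.d (DirectSum.decompose A.gr a i : A.carrier) = 0 := by
  have := A.self.decompose_d a i
  rw [show A.self.d a = 0 from ha, DirectSum.decompose_zero] at this
  exact this.symm.trans rfl

end DGAlgebra

namespace DGModule

variable {A : DGAlgebra k} (M : DGModule A)

lemma exists_cocycle_smul_d {a : A.carrier} (ha : A.d a = 0) (x : M.carrier) :
    ∃ y, a • M.d x = M.d y := by
  classical
  refine ⟨∑ i ∈ (DirectSum.decompose A.gr a).support,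
    i.negOnePow • ((DirectSum.decompose A.gr a i : A.carrier) • x), ?_⟩
  conv_lhs => rw [← DirectSum.sum_support_decompose A.gr a, Finset.sum_smul]
  rw [map_sum]
  refine Finset.sum_congr rfl fun i _ => ?_
  have h := M.leibniz (SetLike.coe_mem (DirectSum.decompose A.gr a i)) x
  rw [A.d_component ha, zero_smul, zero_add] at h
  rw [Units.smul_def, map_zsmul, h, Units.smul_def, smul_smul]
  simp [← Units.val_mul, Int.units_mul_self]

lemma d_cocycle_smul {a : A.carrier} (ha : A.d a = 0) {x : M.carrier} (hx : M.d x = 0) :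
    M.d (a • x) = 0 := by
  classical
  conv_lhs => rw [← DirectSum.sum_support_decompose A.gr a, Finset.sum_smul]
  rw [map_sum]
  refine Finset.sum_eq_zero fun i _ => ?_
  rw [M.leibniz (SetLike.coe_mem _), A.d_component ha, hx]
  simp

lemma d_smul_cocycle (b : A.carrier) {x : M.carrier} (hx : M.d x = 0) :
    M.d (b • x) = A.d b • x := by
  classical
  conv_lhs => rw [← DirectSum.sum_support_decompose A.gr b, Finset.sum_smul]
  conv_rhs => rw [← DirectSum.sum_support_decompose A.gr b]
  rw [map_sum, map_sum, Finset.sum_smul]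
  refine Finset.sum_congr rfl fun i _ => ?_
  rw [M.leibniz (SetLike.coe_mem _), hx]
  simp

end DGModule

/-! ### Cohomology -/

namespace DGAlgebra

variable (A : DGAlgebra k)

lemma d_one : A.d 1 = 0 := by
  have h := A.leibniz (SetLike.one_mem_graded A.gr) 1
  simpa using h

/-- The cocycles of `A`, a subring. -/
def cocycles : Subring A.carrier where
  carrier := {a | A.d a = 0}
  mul_mem' ha hb := A.self.d_cocycle_smul ha hb
  one_mem' := A.d_one
  add_mem' {a b} ha hb := by
    change A.d (a + b) = 0
    rw [map_add, ha, hb, add_zero]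
  zero_mem' := map_zero A.d
  neg_mem' {a} ha := by
    change A.d (-a) = 0
    rw [map_neg, ha, neg_zero]

/-- The coboundaries of `A`, a two-sided ideal of the ring of cocycles. -/
def coboundaries : Ideal A.cocycles where
  carrier := {z | ∃ b, A.d b = z}
  add_mem' {x y} := by
    rintro ⟨b, hb⟩ ⟨c, hc⟩
    exact ⟨b + c, by rw [map_add, hb, hc]; rfl⟩
  zero_mem' := ⟨0, map_zero A.d⟩
  smul_mem' z x := by
    rintro ⟨b, hb⟩
    obtain ⟨y, hy⟩ := A.self.exists_cocycle_smul_d z.2 b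
    refine ⟨y, hy.symm.trans ?_⟩
    change (z : A.carrier) * A.d b = z * x
    rw [hb]

instance : A.coboundaries.IsTwoSided where
  mul_mem_of_left {x} z := by
    rintro ⟨b, hb⟩
    refine ⟨b * z, (A.self.d_smul_cocycle b z.2).trans ?_⟩
    change A.d b * z = x * z
    rw [hb]

/-- The cohomology algebra `H(A)` (the total object `⨁ i, H^i(A)`): cocycles modulo
coboundaries. -/
abbrev Cohomology : Type u := A.cocycles ⧸ A.coboundaries

end DGAlgebra

namespace DGModule

variable {A : DGAlgebra k} (M : DGModule A)

/-- The cocycles of `M`, a module over the ring of cocycles of `A`. -/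
def cocycles : Submodule A.cocycles M.carrier where
  carrier := {x | M.d x = 0}
  add_mem' {x y} hx hy := by
    change M.d (x + y) = 0
    rw [map_add, hx, hy, add_zero]
  zero_mem' := map_zero M.d
  smul_mem' a _ hx := M.d_cocycle_smul a.2 hx

/-- The coboundaries of `M`, a submodule of the cocycles. -/
def coboundaries : Submodule A.cocycles M.cocycles where
  carrier := {z | ∃ y, M.d y = z}
  add_mem' {x y} := by
    rintro ⟨b, hb⟩ ⟨c, hc⟩
    exact ⟨b + c, by rw [map_add, hb, hc]; rfl⟩
  zero_mem' := ⟨0, map_zero M.d⟩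
  smul_mem' a x := by
    rintro ⟨b, hb⟩
    obtain ⟨y, hy⟩ := M.exists_cocycle_smul_d a.2 b
    refine ⟨y, hy.symm.trans ?_⟩
    change (a : A.carrier) • M.d b = (a : A.carrier) • (x : M.carrier)
    rw [hb]

/-- The cohomology `H(M)` (the total object `⨁ i, H^i(M)`): cocycles modulo coboundaries. -/
abbrev Cohomology : Type u := M.cocycles ⧸ M.coboundaries

lemma cohomology_torsion : Module.IsTorsionBySet A.cocycles M.Cohomology A.coboundaries := by
  intro x a
  obtain ⟨x, rfl⟩ := Submodule.Quotient.mk_surjective _ x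
  obtain ⟨⟨a, ha⟩, b, hb⟩ := a
  rw [← Submodule.Quotient.mk_smul, Submodule.Quotient.mk_eq_zero]
  refine ⟨b • x, (M.d_smul_cocycle b x.2).trans ?_⟩
  rw [hb]
  rfl

/-- `H(M)` is a left module over `H(A)`, with `[a] • [x] = [a • x]`. -/
noncomputable instance cohomologyModule : Module A.Cohomology M.Cohomology :=
  M.cohomology_torsion.module

lemma mk_smul_mk (a : A.cocycles) (x : M.cocycles) :
    (Ideal.Quotient.mk A.coboundaries a) • (Submodule.Quotient.mk x : M.Cohomology) =
      Submodule.Quotient.mk (a • x) := rfl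

/-- `M` is cohomologically finite: `H(M)` is a finitely generated `H(A)`-module. -/
def IsCohomologicallyFinite : Prop := Module.Finite A.Cohomology M.Cohomology

/-! ### The category of DG modules -/

/-- A morphism of DG modules: an `A`-linear map of degree `0` commuting with the differentials. -/
@[ext]
structure Hom (M N : DGModule A) where
  toLin : M.carrier →ₗ[A.carrier] N.carrier
  map_mem : ∀ {i : ℤ} {x : M.carrier}, x ∈ M.gr i → toLin x ∈ N.gr i
  comm : ∀ x : M.carrier, toLin (M.d x) = N.d (toLin x)

instance : Category (DGModule A) where
  Hom M N := Hom M N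
  id M := ⟨LinearMap.id, fun h => h, fun _ => rfl⟩
  comp f g := ⟨g.toLin ∘ₗ f.toLin, fun h => g.map_mem (f.map_mem h), fun x => by
    simp [f.comm, g.comm]⟩

variable {M} {N P : DGModule A}

@[ext]
lemma hom_ext {f g : M ⟶ N} (h : ∀ x, f.toLin x = g.toLin x) : f = g :=
  Hom.ext (LinearMap.ext h)

@[simp] lemma id_apply (x : M.carrier) : Hom.toLin (𝟙 M) x = x := rfl

@[simp] lemma comp_apply (f : M ⟶ N) (g : N ⟶ P) (x : M.carrier) :
    (f ≫ g).toLin x = g.toLin (f.toLin x) := rfl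

instance : Zero (M ⟶ N) := ⟨⟨0, fun _ => Submodule.zero_mem _, fun _ => by simp⟩⟩

instance : Add (M ⟶ N) := ⟨fun f g => ⟨f.toLin + g.toLin,
  fun h => Submodule.add_mem _ (f.map_mem h) (g.map_mem h), fun x => by simp [f.comm, g.comm]⟩⟩

instance : Neg (M ⟶ N) := ⟨fun f => ⟨-f.toLin,
  fun h => Submodule.neg_mem _ (f.map_mem h), fun x => by simp [f.comm]⟩⟩

@[simp] lemma zero_apply (x : M.carrier) : Hom.toLin (0 : M ⟶ N) x = 0 := rfl

@[simp] lemma add_apply (f g : M ⟶ N) (x : M.carrier) :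
    Hom.toLin (f + g) x = f.toLin x + g.toLin x := rfl

@[simp] lemma neg_apply (f : M ⟶ N) (x : M.carrier) : Hom.toLin (-f) x = -f.toLin x := rfl

instance : AddCommGroup (M ⟶ N) where
  add_assoc f g h := by ext x; simp [add_assoc]
  add_comm f g := by ext x; simp [add_comm]
  zero_add f := by ext x; simp
  add_zero f := by ext x; simp
  neg_add_cancel f := by ext x; simp
  nsmul := nsmulRec
  zsmul := zsmulRec

instance : Preadditive (DGModule A) where
  add_comp _ _ _ f g h := by ext x; simp
  comp_add _ _ _ f g h := by ext x; simp

/-- The zero DG module. -/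
def zeroModule (A : DGAlgebra k) : DGModule A where
  carrier := PUnit
  gr _ := ⊥
  decomposition := DirectSum.Decomposition.ofLinearMap _ 0
    (by ext) (by ext)
  smul_mem _ _ := rfl
  d := 0
  d_mem _ := rfl
  d_d _ := rfl
  leibniz _ _ := rfl

instance : HasZeroObject (DGModule A) :=
  ⟨zeroModule A, (IsZero.iff_id_eq_zero _).2 (by ext; rfl)⟩

/-- The inclusion of the first summand, on homogeneous components. -/
def inlGr (M N : DGModule A) (i : ℤ) : M.gr i →ₗ[k] (M.gr i).prod (N.gr i) :=
  (LinearMap.inl k M.carrier N.carrier).restrict fun _ hx => ⟨hx, Submodule.zero_mem _⟩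

/-- The inclusion of the second summand, on homogeneous components. -/
def inrGr (M N : DGModule A) (i : ℤ) : N.gr i →ₗ[k] (M.gr i).prod (N.gr i) :=
  (LinearMap.inr k M.carrier N.carrier).restrict fun _ hx => ⟨Submodule.zero_mem _, hx⟩

lemma coe_lmap_inlGr (M N : DGModule A) (x : M.carrier) :
    DirectSum.coeLinearMap (fun i => (M.gr i).prod (N.gr i))
      (DirectSum.lmap (inlGr M N) (DirectSum.decompose M.gr x)) = (x, 0) := by
  induction x using DirectSum.Decomposition.inductionOn M.gr with
  | zero => simp only [DirectSum.decompose_zero, map_zero]; rfl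
  | @homogeneous j x =>
    rw [DirectSum.decompose_coe]
    simp only [DirectSum.lmap_of, DirectSum.coeLinearMap_of]
    rfl
  | add x y hx hy => simp [DirectSum.decompose_add, hx, hy]

lemma coe_lmap_inrGr (M N : DGModule A) (x : N.carrier) :
    DirectSum.coeLinearMap (fun i => (M.gr i).prod (N.gr i))
      (DirectSum.lmap (inrGr M N) (DirectSum.decompose N.gr x)) = (0, x) := by
  induction x using DirectSum.Decomposition.inductionOn N.gr with
  | zero => simp only [DirectSum.decompose_zero, map_zero]; rfl
  | @homogeneous j x =>
    rw [DirectSum.decompose_coe]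
    simp only [DirectSum.lmap_of, DirectSum.coeLinearMap_of]
    rfl
  | add x y hx hy => simp [DirectSum.decompose_add, hx, hy]

/-- The direct sum of two DG modules. -/
def prod (M N : DGModule A) : DGModule A where
  carrier := M.carrier × N.carrier
  gr i := (M.gr i).prod (N.gr i)
  decomposition := DirectSum.Decomposition.ofLinearMap _
    (LinearMap.coprod
      (DirectSum.lmap (inlGr M N) ∘ₗ (DirectSum.decomposeLinearEquiv M.gr).toLinearMap)
      (DirectSum.lmap (inrGr M N) ∘ₗ (DirectSum.decomposeLinearEquiv N.gr).toLinearMap))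
    (by
      refine LinearMap.ext fun x => ?_
      obtain ⟨x, y⟩ := x
      change DirectSum.coeLinearMap (fun i => (M.gr i).prod (N.gr i))
        (DirectSum.lmap (inlGr M N) (DirectSum.decompose M.gr x) +
          DirectSum.lmap (inrGr M N) (DirectSum.decompose N.gr y)) = (x, y)
      rw [map_add, coe_lmap_inlGr, coe_lmap_inrGr, Prod.mk_add_mk, add_zero, zero_add])
    (by
      refine DirectSum.linearMap_ext _ fun i => LinearMap.ext fun x => ?_
      change DirectSum.lmap (inlGr M N) (DirectSum.decompose M.gr
          (DirectSum.coeLinearMap (fun i => (M.gr i).prod (N.gr i)) (DirectSum.lof k ℤ _ i x)).1) +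
        DirectSum.lmap (inrGr M N) (DirectSum.decompose N.gr
          (DirectSum.coeLinearMap (fun i => (M.gr i).prod (N.gr i)) (DirectSum.lof k ℤ _ i x)).2) =
        DirectSum.lof k ℤ _ i x
      rw [DirectSum.coeLinearMap_lof, DirectSum.decompose_of_mem _ x.2.1,
        DirectSum.decompose_of_mem _ x.2.2, DirectSum.lmap_of, DirectSum.lmap_of, ← map_add,
        DirectSum.lof_eq_of]
      congr 1
      exact Subtype.ext (Prod.ext (add_zero _) (zero_add _)))
  smul_mem ha hx := ⟨M.smul_mem ha hx.1, N.smul_mem ha hx.2⟩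
  d := M.d.prodMap N.d
  d_mem hx := ⟨M.d_mem hx.1, N.d_mem hx.2⟩
  d_d x := Prod.ext (M.d_d x.1) (N.d_d x.2)
  leibniz ha x := Prod.ext (M.leibniz ha x.1) (N.leibniz ha x.2)

/-- The direct sum of two DG modules is their biproduct. -/
def prodBicone (M N : DGModule A) : BinaryBicone M N where
  pt := prod M N
  fst := ⟨LinearMap.fst _ _ _, fun h => h.1, fun _ => rfl⟩
  snd := ⟨LinearMap.snd _ _ _, fun h => h.2, fun _ => rfl⟩
  inl := ⟨LinearMap.inl _ _ _, fun h => ⟨h, Submodule.zero_mem _⟩,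
    fun _ => Prod.ext rfl (map_zero N.d).symm⟩
  inr := ⟨LinearMap.inr _ _ _, fun h => ⟨Submodule.zero_mem _, h⟩,
    fun _ => Prod.ext (map_zero M.d).symm rfl⟩
  inl_fst := rfl
  inl_snd := rfl
  inr_fst := rfl
  inr_snd := rfl

instance : HasBinaryBiproducts (DGModule A) := ⟨fun M N =>
  HasBinaryBiproduct.mk ⟨prodBicone M N, isBinaryBilimitOfTotal _ (by
    refine DGModule.hom_ext fun x => ?_
    exact Prod.ext (add_zero x.1) (zero_add x.2))⟩⟩

instance : HasFiniteProducts (DGModule A) := hasFiniteProducts_of_has_binary_and_terminal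

/-! ### Quasi-isomorphisms, the derived category, compact objects -/

/-- The map induced by a morphism on cocycles. -/
def cocyclesMap (f : M ⟶ N) : M.cocycles →ₗ[A.cocycles] N.cocycles where
  toFun x := ⟨f.toLin x, by
    change N.d _ = 0
    rw [← f.comm, show M.d x = 0 from x.2, map_zero]⟩
  map_add' x y := Subtype.ext (map_add f.toLin _ _)
  map_smul' a x := Subtype.ext (map_smul f.toLin (a : A.carrier) (x : M.carrier))

/-- The map `H(f) : H(M) → H(N)` induced by a morphism, `H(f)[x] = [f x]`. -/
def cohomologyMap (f : M ⟶ N) : M.Cohomology →ₗ[A.cocycles] N.Cohomology :=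
  Submodule.mapQ _ _ (cocyclesMap f) (by
    rintro ⟨x, hx⟩ ⟨y, hy⟩
    exact ⟨f.toLin y, (f.comm y).symm.trans (congrArg f.toLin hy)⟩)

/-- Cohomology as a functor. -/
def cohomologyFunctor (A : DGAlgebra k) : DGModule A ⥤ ModuleCat.{u} A.cocycles where
  obj M := ModuleCat.of _ M.Cohomology
  map f := ModuleCat.ofHom (cohomologyMap f)
  map_id M := by
    refine ModuleCat.hom_ext (LinearMap.ext fun x => ?_)
    obtain ⟨x, rfl⟩ := Submodule.Quotient.mk_surjective _ x
    rfl
  map_comp f g := by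
    refine ModuleCat.hom_ext (LinearMap.ext fun x => ?_)
    obtain ⟨x, rfl⟩ := Submodule.Quotient.mk_surjective _ x
    rfl

instance : (cohomologyFunctor A).Additive where
  map_add {M N f g} := by
    refine ModuleCat.hom_ext (LinearMap.ext fun x => ?_)
    obtain ⟨x, rfl⟩ := Submodule.Quotient.mk_surjective _ x
    rfl

/-- The quasi-isomorphisms: the morphisms `f` for which `H(f)` is bijective. -/
def quasiIso (A : DGAlgebra k) : MorphismProperty (DGModule A) :=
  fun _ _ f => Function.Bijective (cohomologyMap f)

lemma quasiIso_eq :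
    quasiIso A = (MorphismProperty.isomorphisms _).inverseImage (cohomologyFunctor A) := by
  ext M N f
  exact (ConcreteCategory.isIso_iff_bijective ((cohomologyFunctor A).map f)).symm

instance : (quasiIso A).ContainsIdentities := by rw [quasiIso_eq]; infer_instance

instance : (quasiIso A).IsStableUnderFiniteProducts where
  isStableUnderProductsOfShape J _ := by
    have : (quasiIso A).RespectsIso := by rw [quasiIso_eq]; infer_instance
    refine MorphismProperty.IsStableUnderProductsOfShape.mk _ _ fun X₁ X₂ _ _ f hf => ?_
    rw [quasiIso_eq]
    change IsIso ((cohomologyFunctor A).map (Limits.Pi.map f))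
    have hf' : ∀ j, IsIso ((cohomologyFunctor A).map (f j)) := fun j => by
      have := hf j
      rw [quasiIso_eq] at this
      exact this
    have : PreservesFiniteProducts (cohomologyFunctor A) :=
      ⟨fun n => preservesProductsOfShape_of_preservesBiproductsOfShape _⟩
    have e : (cohomologyFunctor A).map (Limits.Pi.map f) =
        (PreservesProduct.iso (cohomologyFunctor A) X₁).hom ≫
          Limits.Pi.map (fun j => (cohomologyFunctor A).map (f j)) ≫
            (PreservesProduct.iso (cohomologyFunctor A) X₂).inv := by
      rw [← Category.assoc, Iso.eq_comp_inv]
      refine Limits.Pi.hom_ext _ _ fun j => ?_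
      simp [PreservesProduct.iso_hom, ← Functor.map_comp]
    rw [e]
    infer_instance

/-- The derived category `D(A)`: the category of DG modules with the quasi-isomorphisms
inverted. -/
abbrev DerivedCat (A : DGAlgebra k) : Type (u + 1) := (quasiIso A).Localization

/-- The additive structure of the derived category. It is the unique preadditive structure on this
category; the localization functor is additive by `LocAdd.Q_additive`. -/
noncomputable instance : Preadditive (DerivedCat A) := LocAdd.preadditive (quasiIso A)

/-- `M` is compact: the functor `Hom_{D(A)}(M, -)`, with values in abelian groups, preserves all
(small) coproducts of `D(A)`. -/
def IsCompact (M : DGModule A) : Prop :=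
  ∀ J : Type u, PreservesColimitsOfShape (Discrete J)
    (preadditiveCoyoneda.obj (Opposite.op ((quasiIso A).Q.obj M)))

/-! ### Semi-free DG modules -/

/-- `S` is (the underlying submodule of) a DG submodule of `M`: a graded `A`-submodule stable under
the differential. -/
structure IsDGSubmodule (M : DGModule A) (S : Submodule A.carrier M.carrier) : Prop where
  homogeneous : S.IsHomogeneous M.gr
  d_mem : ∀ x ∈ S, M.d x ∈ S

/-- For DG submodules `P ≤ Q` of `M`, the DG module `Q / P` is DG free, i.e. isomorphic to a direct
sum of suspensions of `A`: it has a basis consisting of homogeneous cocycles. A homogeneous element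
of `Q / P` is the class of a homogeneous element `e` of `Q`, and this class is a cocycle when
`d e ∈ P`. -/
def IsDGFreeQuotient (M : DGModule A) (P Q : Submodule A.carrier M.carrier) : Prop :=
  ∃ (ι : Type u) (b : Module.Basis ι A.carrier (Q ⧸ P.submoduleOf Q)) (e : ι → Q),
    ∀ j, M.IsHomog (e j : M.carrier) ∧ M.d (e j : M.carrier) ∈ P ∧
      b j = Submodule.Quotient.mk (e j)

/-- A semi-free filtration `0 = F(-1) ⊆ F(0) ⊆ F(1) ⊆ ⋯` of `M`: an exhaustive chain of DG
submodules with DG free subquotients. The index is shifted by one: `F n` is the term `F(n-1)`. -/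
structure IsSemiFreeFiltration (M : DGModule A) (F : ℕ → Submodule A.carrier M.carrier) :
    Prop where
  zero : F 0 = ⊥
  mono : Monotone F
  dgSubmodule : ∀ n, M.IsDGSubmodule (F n)
  exhaustive : ∀ x, ∃ n, x ∈ F n
  free : ∀ n, M.IsDGFreeQuotient (F n) (F (n + 1))

/-- `M` is semi-free: it has a semi-free filtration. -/
def IsSemiFree (M : DGModule A) : Prop := ∃ F, M.IsSemiFreeFiltration F

/-- A filtration is strictly increasing if `F(n) ≠ F(n-1)` as long as `F(n-1) ≠ M`. -/
def StrictlyIncreasing (M : DGModule A) (F : ℕ → Submodule A.carrier M.carrier) : Prop :=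
  ∀ n, F n ≠ ⊤ → F n ≠ F (n + 1)

/-- The length of a filtration: the least `n ≥ 0` with `F(n) = M`, and `∞` if there is none. -/
noncomputable def filtrationLength (M : DGModule A) (F : ℕ → Submodule A.carrier M.carrier) : ℕ∞ :=
  ⨅ (n : ℕ) (_ : F (n + 1) = ⊤), (n : ℕ∞)

/-- The DG free class of `M`: the shortest length of a strictly increasing semi-free filtration. -/
noncomputable def dgFreeClass (M : DGModule A) : ℕ∞ :=
  ⨅ (F : ℕ → Submodule A.carrier M.carrier)
    (_ : M.IsSemiFreeFiltration F ∧ M.StrictlyIncreasing F), M.filtrationLength F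

/-- The submodule `𝔪 M`, where `𝔪 = A^1 ⊕ A^2 ⊕ ⋯`. -/
def maxIdealSMul (M : DGModule A) : Submodule A.carrier M.carrier :=
  Submodule.span A.carrier {y | ∃ a ∈ A.maxIdeal, ∃ x : M.carrier, y = a • x}

/-- `M` is minimal: `d M ⊆ 𝔪 M`. -/
def IsMinimal (M : DGModule A) : Prop := ∀ x, M.d x ∈ M.maxIdealSMul

/-- `E` is a semi-basis of `M`: a basis of homogeneous elements over the underlying graded algebra
with a decomposition `E = ⨆ E_u`, `u ≥ 0`, into disjoint subsets such that `d(E_u)` lies in the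
submodule generated by the `E_i` with `i < u` (in particular `d(E_0) = 0`). -/
structure IsSemiBasis (M : DGModule A) (E : Set M.carrier) : Prop where
  homog : ∀ e ∈ E, M.IsHomog e
  linearIndependent : LinearIndependent A.carrier (fun e : E => (e : M.carrier))
  span_eq_top : Submodule.span A.carrier E = ⊤
  decomp : ∃ Es : ℕ → Set M.carrier, E = ⋃ u, Es u ∧ Pairwise (Function.onFun Disjoint Es) ∧
    ∀ u, ∀ e ∈ Es u, M.d e ∈ Submodule.span A.carrier (⋃ i < u, Es i)

end DGModule

end DG

/-! Write Z for the ring of cocycles of A. Finite class gives a semi-free filtration F that reaches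
G after finitely many steps. Lifting bases of the subquotients gives a homogeneous basis of G sorted
into levels, so the first claim amounts to the finiteness of every level.

This is proved together with the assertion that H(G/F n) is Noetherian over Z, by induction on n.
For F 0 = 0 this is H(G), finitely generated over the left Noetherian ring H(A). Suppose that H(G/F
n) is Noetherian. Then finitely many of the classes of level-n basis elements generate the submodule
spanned by all of them. By minimality a coboundary has all its coefficients in 𝔪, so a level-n basis
element outside the finite set would have its own coefficient 1 in 𝔪, which is absurd. Hence level n
is finite (`finite_of_relative_cohomology`), and H(F (n+1)/F n) is a quotient of a finite power of
H(A) (`isNoetherian_of_finite_step`). Exactness of H(G/F n) → H(G/F (n+1)) → H(F (n+1)/F n) then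
gives the next case (`isNoetherian_relative_cohomology`). The differential is Z-linear only up to
sign, so `signedD`, with the same kernel and image, replaces it.

For compactness, a finite semi-basis lets G lift along surjective quasi-isomorphisms
(`exists_lift_of_basis`), so every morphism out of G in D(A) comes from a morphism of DG modules
(`Q_map_surjective_of_lift`). A coproduct in D(A) is a retract of the direct sum of DG modules
(`exists_directSum_desc_derivedCat` supplies the retraction), and a morphism from a finitely
generated module to a direct sum meets only finitely many summands. Only the existence of morphisms
out of the direct sum in D(A) is needed, not their uniqueness. -/

section LinearAlgebra

/-! ### Noetherian modules and the exact sequence of a triple. -/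

variable {R M : Type*} [Ring R] [AddCommGroup M] [Module R M]

/-- Two-out-of-three for the Noetherian property in the long exact sequence of the triple
`P ≤ Q ≤ M` of submodules stable under an operator `D` of square zero. -/
lemma isNoetherian_relative_cohomology (D : M →ₗ[R] M) (hD : ∀ x, D (D x) = 0)
    {P Q : Submodule R M} (hPQ : P ≤ Q)
    [IsNoetherian R (P.comap D ⧸ (LinearMap.range D ⊔ P).submoduleOf (P.comap D))]
    [IsNoetherian R (↥(P.comap D ⊓ Q) ⧸ (Q.map D ⊔ P).submoduleOf (P.comap D ⊓ Q))] :
    IsNoetherian R (Q.comap D ⧸ (LinearMap.range D ⊔ Q).submoduleOf (Q.comap D)) := by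
  -- `f` is the map H(M/P) → H(M/Q) and `g` the connecting map H(M/Q) → H(Q/P) induced by `D`;
  -- exactness in the middle suffices.
  let f : (P.comap D ⧸ (LinearMap.range D ⊔ P).submoduleOf (P.comap D)) →ₗ[R]
      (Q.comap D ⧸ (LinearMap.range D ⊔ Q).submoduleOf (Q.comap D)) :=
    Submodule.mapQ _ _ (Submodule.inclusion (Submodule.comap_mono hPQ)) (by
      intro x hx
      exact sup_le_sup_left hPQ _ hx)
  let g : (Q.comap D ⧸ (LinearMap.range D ⊔ Q).submoduleOf (Q.comap D)) →ₗ[R]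
      (↥(P.comap D ⊓ Q) ⧸ (Q.map D ⊔ P).submoduleOf (P.comap D ⊓ Q)) :=
    Submodule.mapQ _ _ (D.restrict (p := Q.comap D) (q := P.comap D ⊓ Q) (by
      intro x hx
      refine ⟨?_, hx⟩
      change D (D x) ∈ P
      rw [hD]
      exact P.zero_mem)) (by
      rintro ⟨x, hx⟩ hx'
      obtain ⟨_, ⟨y, rfl⟩, q, hq, h⟩ := Submodule.mem_sup.1
        (show x ∈ LinearMap.range D ⊔ Q from hx')
      change D x ∈ Q.map D ⊔ P
      rw [← h, map_add, hD, zero_add]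
      exact Submodule.mem_sup_left ⟨q, hq, rfl⟩)
  refine isNoetherian_of_range_eq_ker f g (le_antisymm ?_ ?_)
  · rintro _ ⟨x, rfl⟩
    obtain ⟨⟨x, hx⟩, rfl⟩ := Submodule.Quotient.mk_surjective _ x
    refine (Submodule.Quotient.mk_eq_zero _).2 ?_
    exact Submodule.mem_sup_right hx
  · intro x hx
    obtain ⟨⟨x, hxQ⟩, rfl⟩ := Submodule.Quotient.mk_surjective _ x
    obtain ⟨_, ⟨q, hq, rfl⟩, p, hp, h⟩ := Submodule.mem_sup.1
      (show D x ∈ Q.map D ⊔ P from (Submodule.Quotient.mk_eq_zero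
        ((Q.map D ⊔ P).submoduleOf (P.comap D ⊓ Q))).1
          (show g (Submodule.Quotient.mk ⟨x, hxQ⟩) = 0 from hx))
    -- Since `D x = D q + p`, subtracting `q` makes `x` a cocycle modulo `P` without changing its
    -- class modulo `Q`.
    have hxq : D (x - q) ∈ P := by
      rw [map_sub, ← h, add_sub_cancel_left]
      exact hp
    refine ⟨Submodule.Quotient.mk ⟨x - q, hxq⟩, (Submodule.Quotient.eq _).2 ?_⟩
    refine Submodule.mem_sup_right (show x - q - x ∈ Q from ?_)
    rw [sub_sub_cancel_left]
    exact Q.neg_mem hq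

/-- Restriction of scalars along a surjection preserves Noetherian modules. -/
lemma isNoetherian_of_surjective_ringHom {S : Type*} [Ring S] [Module S M] (f : R →+* S)
    (hf : Function.Surjective f) (h : ∀ (r : R) (x : M), f r • x = r • x) [IsNoetherian S M] :
    IsNoetherian R M := by
  -- By surjectivity every `R`-submodule is an `S`-submodule, so the ascending chain condition
  -- transfers.
  let φ : Submodule R M → Submodule S M := fun N =>
    { carrier := N
      add_mem' := N.add_mem
      zero_mem' := N.zero_mem
      smul_mem' := fun s x hx => by
        obtain ⟨r, rfl⟩ := hf s
        rw [h]
        exact N.smul_mem r hx }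
  have hφ : StrictMono φ := fun N N' hN => hN
  rw [isNoetherian_iff']
  have : WellFoundedGT (Submodule S M) := isNoetherian_iff'.1 inferInstance
  exact hφ.wellFoundedGT

end LinearAlgebra

/-! ### A differential that is linear over the cocycles. -/

section DG

variable {k : Type u} [Field k] {A : DGAlgebra k}

namespace DGModule

variable (M : DGModule A)

/-- The sign operator `x ↦ (-1)^|x| x`. -/
def sgn : M.carrier →ₗ[k] M.carrier :=
  DirectSum.coeLinearMap M.gr ∘ₗ
    DirectSum.lmap (fun i => (i.negOnePow : ℤ) • (LinearMap.id : M.gr i →ₗ[k] M.gr i)) ∘ₗ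
      (DirectSum.decomposeLinearEquiv M.gr).toLinearMap

variable {M}

lemma sgn_of_mem {i : ℤ} {x : M.carrier} (hx : x ∈ M.gr i) : M.sgn x = i.negOnePow • x := by
  change DirectSum.coeLinearMap M.gr (DirectSum.lmap _ (DirectSum.decompose M.gr x)) = _
  rw [DirectSum.decompose_of_mem _ hx, DirectSum.lmap_of, DirectSum.coeLinearMap_of]
  rfl

lemma smul_units_mem {i : ℤ} {x : M.carrier} (e : ℤˣ) (hx : x ∈ M.gr i) : e • x ∈ M.gr i := by
  rw [Units.smul_def]
  exact zsmul_mem hx _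

@[elab_as_elim]
lemma homog_induction {p : M.carrier → Prop} (zero : p 0)
    (homog : ∀ (i : ℤ) (x : M.carrier), x ∈ M.gr i → p x)
    (add : ∀ x y, p x → p y → p (x + y)) (x : M.carrier) : p x :=
  DirectSum.Decomposition.inductionOn M.gr zero (fun x => homog _ x x.2) add x

lemma negOnePow_smul_smul (i : ℤ) (x : M.carrier) : i.negOnePow • i.negOnePow • x = x := by
  rw [smul_smul, Int.units_mul_self, one_smul]

lemma sgn_sgn (x : M.carrier) : M.sgn (M.sgn x) = x := by
  induction x using homog_induction with
  | zero => simp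
  | homog i x hx =>
    rw [sgn_of_mem hx, sgn_of_mem (smul_units_mem _ hx), negOnePow_smul_smul]
  | add x y hx hy => rw [map_add, map_add, hx, hy]

lemma sgn_d (x : M.carrier) : M.sgn (M.d x) = -M.d (M.sgn x) := by
  induction x using homog_induction with
  | zero => simp
  | homog i x hx =>
    rw [sgn_of_mem hx, sgn_of_mem (M.d_mem hx), Int.negOnePow_succ, Units.smul_def, Units.smul_def,
      map_zsmul, Units.val_neg, neg_smul]
  | add x y hx hy => rw [map_add, map_add, hx, hy, map_add, map_add]; abel

lemma sgn_smul {i : ℤ} {a : A.carrier} (ha : a ∈ A.gr i) (x : M.carrier) :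
    M.sgn (a • x) = i.negOnePow • (a • M.sgn x) := by
  induction x using homog_induction with
  | zero => simp
  | homog j x hx =>
    rw [sgn_of_mem hx, sgn_of_mem (M.smul_mem ha hx), Int.negOnePow_add, mul_smul,
      Units.smul_def, Units.smul_def, Units.smul_def, Units.smul_def, smul_comm a]
  | add x y hx hy => rw [smul_add, map_add, hx, hy, map_add, smul_add, smul_add]

variable (M)

/-- The differential with a sign, `x ↦ d ((-1)^|x| x)`; it is linear over the cocycles of `A`. -/
def signedD : M.carrier →ₗ[A.cocycles] M.carrier where
  toFun x := M.d (M.sgn x)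
  map_add' x y := by rw [map_add, map_add]
  map_smul' a x := by
    classical
    obtain ⟨a, ha⟩ := a
    change M.d (M.sgn (a • x)) = a • M.d (M.sgn x)
    rw [← DirectSum.sum_support_decompose A.gr a, Finset.sum_smul, Finset.sum_smul, map_sum,
      map_sum]
    refine Finset.sum_congr rfl fun i _ => ?_
    have hi := SetLike.coe_mem (DirectSum.decompose A.gr a i)
    -- The components of a cocycle are cocycles, so Leibniz leaves only the sign (-1)^i, which
    -- cancels the one from `sgn`.
    rw [sgn_smul hi, Units.smul_def, map_zsmul, M.leibniz hi, A.d_component ha, zero_smul, zero_add,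
      ← Units.smul_def, negOnePow_smul_smul]

variable {M}

lemma signedD_apply (x : M.carrier) : M.signedD x = M.d (M.sgn x) := rfl

lemma signedD_signedD (x : M.carrier) : M.signedD (M.signedD x) = 0 := by
  rw [signedD_apply, signedD_apply, sgn_d, map_neg, M.d_d, neg_zero]

lemma range_signedD (x : M.carrier) : x ∈ LinearMap.range M.signedD ↔ ∃ y, M.d y = x :=
  ⟨fun ⟨y, hy⟩ => ⟨M.sgn y, hy⟩, fun ⟨y, hy⟩ => ⟨M.sgn y, by rw [signedD_apply, sgn_sgn, hy]⟩⟩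

lemma IsDGSubmodule.sgn_mem {S : Submodule A.carrier M.carrier} (hS : M.IsDGSubmodule S)
    {x : M.carrier} (hx : x ∈ S) : M.sgn x ∈ S := by
  classical
  rw [← DirectSum.sum_support_decompose M.gr x, map_sum]
  refine S.sum_mem fun i _ => ?_
  rw [sgn_of_mem (SetLike.coe_mem _), Units.smul_def]
  exact zsmul_mem (hS.homogeneous i hx) _

/-- `signedD` equals `-sgn ∘ d`, and the involution `sgn` preserves graded submodules. Thus relative
cocycles are the same for both differentials. -/
lemma IsDGSubmodule.signedD_mem_iff {S : Submodule A.carrier M.carrier} (hS : M.IsDGSubmodule S)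
    {x : M.carrier} : M.signedD x ∈ S ↔ M.d x ∈ S := by
  refine ⟨fun h => ?_, fun h => ?_⟩
  · have := hS.sgn_mem h
    rw [signedD_apply, sgn_d, sgn_sgn] at this
    exact S.neg_mem_iff.1 this
  · have := S.neg_mem (hS.sgn_mem h)
    rwa [sgn_d, neg_neg] at this

end DGModule

end DG

/-! ### Bases from filtrations with free subquotients. -/

section Filtration

variable {R M : Type u} [Ring R] [AddCommGroup M] [Module R M]

/-- Expanding the class of an element of `F (n + 1)` in the basis of the subquotient and subtracting
the lifted expansion leaves a remainder in `F n`, to which induction applies. -/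
lemma span_lower_eq_of_filtration {F : ℕ → Submodule R M} (h0 : F 0 = ⊥) (hF : Monotone F)
    {ι : ℕ → Type u} (b : ∀ n, Module.Basis (ι n) R (F (n + 1) ⧸ (F n).submoduleOf (F (n + 1))))
    (e : ∀ n, ι n → F (n + 1)) (hb : ∀ n j, b n j = Submodule.Quotient.mk (e n j)) (n : ℕ) :
    F n = Submodule.span R ((fun p : Σ n, ι n => (e p.1 p.2 : M)) '' {p | p.1 < n}) := by
  refine le_antisymm ?_ ?_
  · induction n with
    | zero => rw [h0]; exact bot_le
    | succ n ih =>
      intro x hx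
      have h := (b n).linearCombination_repr (Submodule.Quotient.mk ⟨x, hx⟩)
      rw [Finsupp.linearCombination_apply, Finsupp.sum] at h
      simp only [hb] at h
      have h' : x - ∑ j ∈ ((b n).repr (Submodule.Quotient.mk ⟨x, hx⟩)).support,
          ((b n).repr (Submodule.Quotient.mk ⟨x, hx⟩)) j • (e n j : M) ∈ F n := by
        have : (Submodule.Quotient.mk (⟨x, hx⟩ -
            ∑ j ∈ ((b n).repr (Submodule.Quotient.mk ⟨x, hx⟩)).support,
              ((b n).repr (Submodule.Quotient.mk ⟨x, hx⟩)) j • e n j) :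
            F (n + 1) ⧸ (F n).submoduleOf (F (n + 1))) = 0 := by
          rw [Submodule.Quotient.mk_sub, ← Submodule.mkQ_apply _ (Finset.sum _ _), map_sum]
          simp only [map_smul, Submodule.mkQ_apply]
          rw [h, sub_self]
        have := (Submodule.Quotient.mk_eq_zero _).1 this
        simpa [Submodule.submoduleOf] using this
      rw [← sub_add_cancel x]
      refine Submodule.add_mem _ (Submodule.span_mono (Set.image_mono fun p hp => ?_) (ih h'))
        (Submodule.sum_mem _ fun j _ => Submodule.smul_mem _ _ (Submodule.subset_span ?_))
      · exact Nat.lt_succ_of_lt hp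
      · exact ⟨⟨n, j⟩, Nat.lt_succ_self n, rfl⟩
  · rw [Submodule.span_le]
    rintro _ ⟨p, hp, rfl⟩
    exact hF (Nat.succ_le_of_lt hp) (e p.1 p.2).2

/-- In a nontrivial relation, consider the highest level carrying a nonzero coefficient: modulo the
term below it, the relation becomes one among basis elements of a single subquotient. -/
lemma linearIndependent_of_filtration {F : ℕ → Submodule R M} (hF : Monotone F)
    {ι : ℕ → Type u} (b : ∀ n, Module.Basis (ι n) R (F (n + 1) ⧸ (F n).submoduleOf (F (n + 1))))
    (e : ∀ n, ι n → F (n + 1)) (hb : ∀ n j, b n j = Submodule.Quotient.mk (e n j)) :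
    LinearIndependent R (fun p : Σ n, ι n => (e p.1 p.2 : M)) := by
  classical
  rw [linearIndependent_iff']
  intro s c hc
  by_contra! hne
  obtain ⟨p, hp, hcp⟩ := hne
  obtain ⟨q, hq, hmax⟩ := (s.filter (c · ≠ 0)).exists_max_image Sigma.fst
    ⟨p, Finset.mem_filter.2 ⟨hp, hcp⟩⟩
  obtain ⟨n, j⟩ := q
  rw [Finset.mem_filter] at hq
  let s' : Finset (ι n) := s.preimage (Sigma.mk n) sigma_mk_injective.injOn
  -- The level-`n` part is minus the sum of the rest, whose nonzero terms have level below `n` by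
  -- maximality.
  have hlow : ∑ j ∈ s', c ⟨n, j⟩ • (e n j : M) ∈ F n := by
    have h1 : ∑ p ∈ s.filter (fun p => p.1 = n), c p • (e p.1 p.2 : M) =
        ∑ j ∈ s', c ⟨n, j⟩ • (e n j : M) := by
      refine (Finset.sum_bij (fun j _ => (⟨n, j⟩ : Σ n, ι n)) ?_ ?_ ?_ ?_).symm
      · intro j hj
        exact Finset.mem_filter.2 ⟨Finset.mem_preimage.1 hj, rfl⟩
      · intro i _ j _ h
        exact sigma_mk_injective h
      · rintro ⟨m, i⟩ hi
        obtain ⟨his, hm⟩ := Finset.mem_filter.1 hi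
        change m = n at hm
        subst hm
        exact ⟨i, Finset.mem_preimage.2 his, rfl⟩
      · intro j _
        rfl
    have h2 := Finset.sum_filter_add_sum_filter_not s (fun p => p.1 = n)
      (fun p => c p • (e p.1 p.2 : M))
    rw [hc, h1] at h2
    rw [eq_neg_of_add_eq_zero_left h2]
    refine Submodule.neg_mem _ (Submodule.sum_mem _ fun p hp => ?_)
    obtain ⟨hp, hpn⟩ := Finset.mem_filter.1 hp
    by_cases hcp : c p = 0
    · rw [hcp, zero_smul]
      exact Submodule.zero_mem _
    · have : p.1 ≤ n := hmax p (Finset.mem_filter.2 ⟨hp, hcp⟩)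
      exact Submodule.smul_mem _ _ (hF (Nat.succ_le_of_lt (lt_of_le_of_ne this hpn)) (e p.1 p.2).2)
  have h3 : (Submodule.Quotient.mk (∑ j ∈ s', c ⟨n, j⟩ • e n j) :
      F (n + 1) ⧸ (F n).submoduleOf (F (n + 1))) = 0 := by
    refine (Submodule.Quotient.mk_eq_zero _).2 ?_
    simpa [Submodule.submoduleOf] using hlow
  rw [← Submodule.mkQ_apply, map_sum] at h3
  simp only [map_smul, Submodule.mkQ_apply, ← hb] at h3
  exact hq.2 (linearIndependent_iff'.1 (b n).linearIndependent s' (fun j => c ⟨n, j⟩) h3 j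
    (Finset.mem_preimage.2 hq.1))

end Filtration

section DG

variable {k : Type u} [Field k] {A : DGAlgebra k}

namespace DGModule

variable {M : DGModule A}

/-- A semi-free filtration gives a homogeneous basis, graded by the steps of the filtration. -/
lemma IsSemiFreeFiltration.exists_basis {F : ℕ → Submodule A.carrier M.carrier}
    (hF : M.IsSemiFreeFiltration F) :
    ∃ (ι : ℕ → Type u) (b : Module.Basis (Σ n, ι n) A.carrier M.carrier),
      (∀ p, M.IsHomog (b p)) ∧ (∀ n, F n = Submodule.span A.carrier (b '' {p | p.1 < n})) ∧
        ∀ p, M.d (b p) ∈ F p.1 := by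
  choose ι b e h using hF.free
  have hb : ∀ n j, b n j = Submodule.Quotient.mk (e n j) := fun n j => (h n j).2.2
  have hspan := span_lower_eq_of_filtration hF.zero hF.mono b e hb
  let B := Module.Basis.mk (linearIndependent_of_filtration hF.mono b e hb) (by
    intro x _
    obtain ⟨n, hn⟩ := hF.exhaustive x
    rw [hspan] at hn
    exact Submodule.span_mono (Set.image_subset_range _ _) hn)
  have hB : ⇑B = fun p : Σ n, ι n => (e p.1 p.2 : M.carrier) := Module.Basis.coe_mk _ _
  refine ⟨ι, B, fun p => ?_, fun n => ?_, fun p => ?_⟩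
  · rw [hB]
    exact (h p.1 p.2).1
  · rw [hB]
    exact hspan n
  · rw [hB]
    exact (h p.1 p.2).2.1

end DGModule

/-! ### The augmentation ideal -/

namespace DGAlgebra

lemma IsConnected.eq_zero_of_neg (hA : A.IsConnected) {i : ℤ} {a : A.carrier} (ha : a ∈ A.gr i)
    (hi : i < 0) : a = 0 := by
  rwa [hA.gr_neg i hi, Submodule.mem_bot] at ha

lemma mem_maxIdeal_of_pos {i : ℤ} {a : A.carrier} (ha : a ∈ A.gr i) (hi : 0 < i) :
    a ∈ A.maxIdeal :=
  Submodule.mem_iSup_of_mem (p := fun i : {i : ℤ // 0 < i} => A.gr i) ⟨i, hi⟩ ha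

lemma decompose_zero_of_mem_maxIdeal {a : A.carrier} (ha : a ∈ A.maxIdeal) :
    (DirectSum.decompose A.gr a 0 : A.carrier) = 0 := by
  refine Submodule.iSup_induction (fun i : {i : ℤ // 0 < i} => A.gr i)
    (motive := fun a => (DirectSum.decompose A.gr a 0 : A.carrier) = 0) ha ?_ ?_ ?_
  · intro i x hx
    exact DirectSum.decompose_of_mem_ne _ hx i.2.ne'
  · simp
  · intro x y hx hy
    simp [DirectSum.decompose_add, hx, hy]

/-- Connectedness removes the components of negative degree, so multiplication cannot lower a
positive degree. -/
lemma mul_mem_maxIdeal_left (hA : A.IsConnected) (a : A.carrier) {b : A.carrier}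
    (hb : b ∈ A.maxIdeal) : a * b ∈ A.maxIdeal := by
  classical
  refine Submodule.iSup_induction (fun i : {i : ℤ // 0 < i} => A.gr i)
    (motive := fun b => a * b ∈ A.maxIdeal) hb ?_ ?_ ?_
  · rintro ⟨i, hi⟩ x hx
    rw [← DirectSum.sum_support_decompose A.gr a, Finset.sum_mul]
    refine Submodule.sum_mem _ fun j _ => ?_
    have hj := SetLike.coe_mem (DirectSum.decompose A.gr a j)
    by_cases h : j < 0
    · rw [hA.eq_zero_of_neg hj h, zero_mul]
      exact Submodule.zero_mem _
    · exact mem_maxIdeal_of_pos (SetLike.mul_mem_graded hj hx)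
        (add_pos_of_nonneg_of_pos (not_lt.1 h) hi)
  · rw [mul_zero]
    exact Submodule.zero_mem _
  · intro x y hx hy
    rw [mul_add]
    exact Submodule.add_mem _ hx hy

lemma mul_mem_maxIdeal_right (hA : A.IsConnected) {a : A.carrier} (ha : a ∈ A.maxIdeal)
    (b : A.carrier) : a * b ∈ A.maxIdeal := by
  classical
  refine Submodule.iSup_induction (fun i : {i : ℤ // 0 < i} => A.gr i)
    (motive := fun a => a * b ∈ A.maxIdeal) ha ?_ ?_ ?_
  · rintro ⟨i, hi⟩ x hx
    rw [← DirectSum.sum_support_decompose A.gr b, Finset.mul_sum]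
    refine Submodule.sum_mem _ fun j _ => ?_
    have hj := SetLike.coe_mem (DirectSum.decompose A.gr b j)
    by_cases h : j < 0
    · rw [hA.eq_zero_of_neg hj h, mul_zero]
      exact Submodule.zero_mem _
    · exact mem_maxIdeal_of_pos (SetLike.mul_mem_graded hx hj)
        (add_pos_of_pos_of_nonneg hi (not_lt.1 h))
  · rw [zero_mul]
    exact Submodule.zero_mem _
  · intro x y hx hy
    rw [add_mul]
    exact Submodule.add_mem _ hx hy

lemma one_notMem_maxIdeal (hA : A.IsConnected) : (1 : A.carrier) ∉ A.maxIdeal := by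
  intro h
  have := decompose_zero_of_mem_maxIdeal h
  rw [DirectSum.decompose_of_mem_same _ (SetLike.one_mem_graded A.gr)] at this
  have := hA.nontrivial
  exact one_ne_zero ‹_›

end DGAlgebra

/-! ### Finiteness of each level of the basis. -/

namespace DGModule

variable {M : DGModule A}

/-- The coefficients of `a • y` are `a` times those of `y`, and 𝔪 is a two-sided ideal. Minimality
enters the argument through this lemma. -/
lemma repr_mem_maxIdeal (hA : A.IsConnected) {ι : Type*}
    (b : Module.Basis ι A.carrier M.carrier) {x : M.carrier} (hx : x ∈ M.maxIdealSMul) (i : ι) :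
    b.repr x i ∈ A.maxIdeal := by
  refine Submodule.span_induction (p := fun x _ => b.repr x i ∈ A.maxIdeal) ?_ ?_ ?_ ?_ hx
  · rintro _ ⟨a, ha, y, rfl⟩
    rw [map_smul, Finsupp.smul_apply]
    exact DGAlgebra.mul_mem_maxIdeal_right hA ha _
  · rw [map_zero]
    exact Submodule.zero_mem _
  · intro x y _ _ hx hy
    rw [map_add]
    exact Submodule.add_mem _ hx hy
  · intro a x _ hx
    rw [map_smul]
    exact DGAlgebra.mul_mem_maxIdeal_left hA a hx

/-- If `H(M / P)` is Noetherian over the cocycles of `A`, then only finitely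
many basis elements of the minimal DG module `M` have their differential in `P`. -/
lemma finite_of_relative_cohomology (hA : A.IsConnected) (hmin : M.IsMinimal) {ι : ℕ → Type u}
    (b : Module.Basis (Σ n, ι n) A.carrier M.carrier) {n : ℕ}
    {P : Submodule A.carrier M.carrier} (hP : M.IsDGSubmodule P)
    (hPb : P = Submodule.span A.carrier (b '' {p | p.1 < n}))
    (hd : ∀ j, M.d (b ⟨n, j⟩) ∈ P)
    [IsNoetherian A.cocycles ((P.restrictScalars A.cocycles).comap M.signedD ⧸
      (LinearMap.range M.signedD ⊔ P.restrictScalars A.cocycles).submoduleOf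
        ((P.restrictScalars A.cocycles).comap M.signedD))] :
    Finite (ι n) := by
  classical
  have hd' : ∀ j, b ⟨n, j⟩ ∈ (P.restrictScalars A.cocycles).comap M.signedD :=
    fun j => hP.signedD_mem_iff.2 (hd j)
  let c : ι n → ((P.restrictScalars A.cocycles).comap M.signedD ⧸
      (LinearMap.range M.signedD ⊔ P.restrictScalars A.cocycles).submoduleOf
        ((P.restrictScalars A.cocycles).comap M.signedD)) :=
    fun j => Submodule.Quotient.mk ⟨b ⟨n, j⟩, hd' j⟩
  -- The generators of the Noetherian span can be chosen among the classes `c j` themselves.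
  obtain ⟨t, ht, hspan⟩ := (Submodule.fg_span_iff_fg_span_finset_subset (Set.range c)).1
    (IsNoetherian.noetherian (Submodule.span A.cocycles (Set.range c)))
  rw [← Set.image_univ] at ht
  obtain ⟨s, -, rfl⟩ := Finset.subset_set_image_iff.1 ht
  refine Set.finite_univ_iff.1 (s.finite_toSet.subset fun j _ => ?_)
  by_contra hj
  -- `K` tests the coefficient at `⟨n, j⟩` modulo 𝔪. It contains coboundaries by minimality, `P`
  -- because `P` is spanned by lower levels, and all the other basis elements.
  let K : Submodule A.cocycles M.carrier :=
    { carrier := {x | b.repr x ⟨n, j⟩ ∈ A.maxIdeal}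
      add_mem' := fun {x y} hx hy => by
        change b.repr (x + y) ⟨n, j⟩ ∈ A.maxIdeal
        rw [map_add]
        exact Submodule.add_mem _ hx hy
      zero_mem' := by
        change b.repr 0 ⟨n, j⟩ ∈ A.maxIdeal
        rw [map_zero]
        exact Submodule.zero_mem _
      smul_mem' := fun a x hx => by
        change b.repr ((a : A.carrier) • x) ⟨n, j⟩ ∈ A.maxIdeal
        rw [map_smul]
        exact DGAlgebra.mul_mem_maxIdeal_left hA a hx }
  have hK : ∀ p : Σ n, ι n, p ≠ ⟨n, j⟩ → b p ∈ K := fun p hp => by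
    change b.repr (b p) ⟨n, j⟩ ∈ A.maxIdeal
    rw [b.repr_self, Finsupp.single_eq_of_ne hp.symm]
    exact Submodule.zero_mem _
  have hle : LinearMap.range M.signedD ⊔ P.restrictScalars A.cocycles ≤ K := by
    refine sup_le ?_ ?_
    · rintro _ ⟨x, rfl⟩
      exact repr_mem_maxIdeal hA b (hmin _) _
    · intro x hx
      change b.repr x ⟨n, j⟩ ∈ A.maxIdeal
      rw [Submodule.restrictScalars_mem, hPb, b.mem_span_image] at hx
      rw [Finsupp.notMem_support_iff.1 fun h => lt_irrefl n (hx h)]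
      exact Submodule.zero_mem _
  -- The class `c j` is a combination of classes `c i` with `i ≠ j`, so it is represented by an
  -- element of `K`. This forces `b ⟨n, j⟩`, with coefficient 1, into `K`.
  have hmem : c j ∈ (K.submoduleOf ((P.restrictScalars A.cocycles).comap M.signedD)).map
      (Submodule.mkQ _) := by
    refine (hspan.le.trans (Submodule.span_le.2 ?_)) (Submodule.subset_span ⟨j, rfl⟩)
    rw [Finset.coe_image]
    rintro _ ⟨i, hi, rfl⟩
    refine ⟨⟨b ⟨n, i⟩, hd' i⟩, hK _ fun h => hj ?_, rfl⟩
    rwa [← sigma_mk_injective h]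
  obtain ⟨x, hx, hxj⟩ := hmem
  have h1 : (b ⟨n, j⟩ : M.carrier) - x ∈ K := hle (show _ ∈ _ from (Submodule.Quotient.eq
    ((LinearMap.range M.signedD ⊔ P.restrictScalars A.cocycles).submoduleOf
      ((P.restrictScalars A.cocycles).comap M.signedD))).1 hxj.symm)
  have h2 : b ⟨n, j⟩ ∈ K := by
    rw [← sub_add_cancel (b ⟨n, j⟩) (x : M.carrier)]
    exact K.add_mem h1 hx
  refine DGAlgebra.one_notMem_maxIdeal hA ?_
  have h3 : b.repr (b ⟨n, j⟩) ⟨n, j⟩ ∈ A.maxIdeal := h2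
  rwa [b.repr_self, Finsupp.single_eq_same] at h3

/-- The cohomology of a finitely generated DG free quotient `Q / P` is Noetherian. -/
lemma isNoetherian_of_finite_step {ι : ℕ → Type u}
    [IsNoetherian A.cocycles A.Cohomology]
    (b : Module.Basis (Σ n, ι n) A.carrier M.carrier) {n : ℕ} [Finite (ι n)]
    {P Q : Submodule A.carrier M.carrier} (hP : M.IsDGSubmodule P) (hQ : M.IsDGSubmodule Q)
    (hPb : P = Submodule.span A.carrier (b '' {p | p.1 < n}))
    (hQb : Q = Submodule.span A.carrier (b '' {p | p.1 < n + 1}))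
    (hd : ∀ j, M.d (b ⟨n, j⟩) ∈ P) :
    IsNoetherian A.cocycles
      (↥((P.restrictScalars A.cocycles).comap M.signedD ⊓ Q.restrictScalars A.cocycles) ⧸
        ((Q.restrictScalars A.cocycles).map M.signedD ⊔ P.restrictScalars A.cocycles).submoduleOf
          ((P.restrictScalars A.cocycles).comap M.signedD ⊓ Q.restrictScalars A.cocycles)) := by
  classical
  have := Fintype.ofFinite (ι n)
  set P' := P.restrictScalars A.cocycles
  set Q' := Q.restrictScalars A.cocycles
  have hmem : ∀ j, b ⟨n, j⟩ ∈ Q := fun j => by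
    rw [hQb]
    exact Submodule.subset_span ⟨⟨n, j⟩, Nat.lt_succ_self n, rfl⟩
  -- Modulo `P` the element `b ⟨n, j⟩` is a cocycle, so only the term `A.d a • b ⟨n, j⟩` of the
  -- Leibniz rule survives.
  have hdsmul : ∀ (a : A.carrier) (j : ι n), M.d (a • b ⟨n, j⟩) - A.d a • b ⟨n, j⟩ ∈ P := by
    intro a j
    rw [← DirectSum.sum_support_decompose A.gr a, Finset.sum_smul, map_sum, map_sum,
      Finset.sum_smul, ← Finset.sum_sub_distrib]
    refine Submodule.sum_mem _ fun i _ => ?_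
    rw [M.leibniz (SetLike.coe_mem _), add_sub_cancel_left, Units.smul_def]
    exact zsmul_mem (P.smul_mem _ (hd j)) _
  -- The map `[a] ↦ [a • b ⟨n, j⟩]`; by `hdsmul` a coboundary `a = d c` goes to the coboundary of `c
  -- • b ⟨n, j⟩` modulo `P`. Jointly these maps will be surjective.
  let φ (j : ι n) : A.Cohomology →ₗ[A.cocycles]
      (↥(P'.comap M.signedD ⊓ Q') ⧸
        (Q'.map M.signedD ⊔ P').submoduleOf (P'.comap M.signedD ⊓ Q')) :=
    Submodule.mapQ A.coboundaries _
      (LinearMap.toSpanSingleton A.cocycles _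
        (⟨b ⟨n, j⟩, hP.signedD_mem_iff.2 (hd j), hmem j⟩ : ↥(P'.comap M.signedD ⊓ Q')))
      (by
        rintro ⟨a, ha⟩ ⟨c, hc⟩
        change a • b ⟨n, j⟩ ∈ Q'.map M.signedD ⊔ P'
        rw [show a • b ⟨n, j⟩ = M.d (c • b ⟨n, j⟩) - (M.d (c • b ⟨n, j⟩) - a • b ⟨n, j⟩) by abel]
        refine Submodule.sub_mem _ (Submodule.mem_sup_left
          ⟨M.sgn (c • b ⟨n, j⟩), hQ.sgn_mem (Q.smul_mem _ (hmem j)), ?_⟩)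
          (Submodule.mem_sup_right ?_)
        · rw [signedD_apply, sgn_sgn]
        · rw [← show A.d c = a from hc]
          exact hdsmul c j)
  refine isNoetherian_of_surjective (M := ι n → A.Cohomology) (LinearMap.lsum A.cocycles _ ℕ φ)
    (LinearMap.range_eq_top.2 fun x => ?_)
  obtain ⟨⟨x, hxP, hxQ⟩, rfl⟩ := Submodule.Quotient.mk_surjective _ x
  have hcoeff : ∀ (c : ι n → A.carrier) (p : Σ n, ι n),
      b.repr (∑ j, c j • b ⟨n, j⟩) p = ∑ j, if ⟨n, j⟩ = p then c j else 0 := fun c p => by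
    rw [map_sum, Finsupp.finsetSum_apply]
    refine Finset.sum_congr rfl fun j _ => ?_
    rw [map_smul, b.repr_self, Finsupp.smul_apply, Finsupp.single_apply, smul_eq_mul, mul_ite,
      mul_one, mul_zero]
  have hcoeff' : ∀ (c : ι n → A.carrier) (i : ι n),
      b.repr (∑ j, c j • b ⟨n, j⟩) ⟨n, i⟩ = c i := fun c i => by
    rw [hcoeff, Finset.sum_eq_single i]
    · rw [if_pos rfl]
    · intro j _ hj
      rw [if_neg fun h => hj (sigma_mk_injective h)]
    · exact fun h => (h (Finset.mem_univ _)).elim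
  have hx : x - ∑ j, b.repr x ⟨n, j⟩ • b ⟨n, j⟩ ∈ P := by
    rw [hPb, b.mem_span_image]
    rintro ⟨m, i⟩ hp
    rw [Finset.mem_coe, Finsupp.mem_support_iff, map_sub, Finsupp.sub_apply] at hp
    by_contra hm
    refine hp ?_
    rcases eq_or_lt_of_le (not_lt.1 (show ¬ m < n from hm)) with h | hlt
    · subst m
      rw [hcoeff', sub_self]
    · rw [hcoeff, Finset.sum_eq_zero, sub_zero]
      · replace hxQ : x ∈ Q := hxQ
        rw [hQb, b.mem_span_image] at hxQ
        by_contra h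
        exact absurd (show m < n + 1 from hxQ (Finsupp.mem_support_iff.2 h)) (not_lt.2 hlt)
      · intro j _
        rw [if_neg]
        rintro ⟨⟩
        exact lt_irrefl _ hlt
  -- Differentiating `x ≡ ∑ c j • b ⟨n, j⟩` modulo `P` gives `∑ d (c j) • b ⟨n, j⟩ ∈ P`. Elements of
  -- `P` have no level-`n` coefficients.
  have hcocycle : ∀ j, A.d (b.repr x ⟨n, j⟩) = 0 := by
    intro j
    have h1 : ∑ j, A.d (b.repr x ⟨n, j⟩) • b ⟨n, j⟩ ∈ P := by
      have h2 := P.sum_mem fun j (_ : j ∈ Finset.univ) => hdsmul (b.repr x ⟨n, j⟩) j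
      rw [Finset.sum_sub_distrib, ← map_sum] at h2
      have h3 := hP.d_mem _ hx
      rw [map_sub] at h3
      have h4 := P.sub_mem (P.sub_mem (hP.signedD_mem_iff.1 hxP) h3) h2
      rwa [sub_sub_cancel, sub_sub_cancel] at h4
    rw [hPb, b.mem_span_image] at h1
    rw [← hcoeff' (fun j => A.d (b.repr x ⟨n, j⟩)) j]
    exact Finsupp.notMem_support_iff.1 fun h => lt_irrefl n (h1 h)
  refine ⟨fun j => Ideal.Quotient.mk A.coboundaries ⟨b.repr x ⟨n, j⟩, hcocycle j⟩, ?_⟩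
  rw [LinearMap.lsum_apply, LinearMap.sum_apply]
  let y (j : ι n) : ↥(P'.comap M.signedD ⊓ Q') :=
    (⟨b.repr x ⟨n, j⟩, hcocycle j⟩ : A.cocycles) • ⟨b ⟨n, j⟩, hP.signedD_mem_iff.2 (hd j), hmem j⟩
  change ∑ j, (Submodule.mkQ _) (y j) = Submodule.mkQ _ _
  rw [← map_sum, Eq.comm, ← sub_eq_zero, ← map_sub]
  refine (Submodule.Quotient.mk_eq_zero _).2 (Submodule.mem_sup_right ?_)
  change x - Submodule.subtype _ (∑ j, y j) ∈ P
  rw [map_sum]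
  exact hx

/-- Base case of the induction: relative to zero, the signed differential has the usual cocycles and
coboundaries, so this is a quotient of H(M). -/
lemma isNoetherian_relative_cohomology_bot [IsNoetherian A.cocycles M.Cohomology] :
    IsNoetherian A.cocycles
      (((⊥ : Submodule A.carrier M.carrier).restrictScalars A.cocycles).comap M.signedD ⧸
      (LinearMap.range M.signedD ⊔
        (⊥ : Submodule A.carrier M.carrier).restrictScalars A.cocycles).submoduleOf
        (((⊥ : Submodule A.carrier M.carrier).restrictScalars A.cocycles).comap M.signedD)) := by
  have hmem : ∀ x, x ∈ M.cocycles →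
      x ∈ ((⊥ : Submodule A.carrier M.carrier).restrictScalars A.cocycles).comap M.signedD := by
    intro x hx
    change M.d (M.sgn x) = 0
    rw [← neg_eq_zero, ← sgn_d, show M.d x = 0 from hx, map_zero]
  refine isNoetherian_of_surjective (M := M.Cohomology)
    (Submodule.mapQ M.coboundaries _ (Submodule.inclusion hmem) ?_)
    (LinearMap.range_eq_top.2 fun x => ?_)
  · rintro x ⟨y, hy⟩
    exact Submodule.mem_sup_left ((range_signedD _).2 ⟨y, hy⟩)
  · obtain ⟨⟨x, hx⟩, rfl⟩ := Submodule.Quotient.mk_surjective _ x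
    refine ⟨Submodule.Quotient.mk ⟨x, ?_⟩, rfl⟩
    have h : M.d (M.sgn x) = 0 := hx
    change M.d x = 0
    rw [← M.sgn_sgn (M.d x), sgn_d, h, neg_zero, map_zero]

/-- A minimal semi-free DG module with finitely generated cohomology over a DG algebra with
Noetherian cohomology has finitely many basis elements in each step of a semi-free filtration. -/
lemma finite_basis_step (hA : A.IsConnected) (hN : IsNoetherianRing A.Cohomology)
    (hmin : M.IsMinimal) (hfg : M.IsCohomologicallyFinite)
    {F : ℕ → Submodule A.carrier M.carrier} (hF : M.IsSemiFreeFiltration F) {ι : ℕ → Type u}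
    (b : Module.Basis (Σ n, ι n) A.carrier M.carrier)
    (hFb : ∀ n, F n = Submodule.span A.carrier (b '' {p | p.1 < n}))
    (hd : ∀ p, M.d (b p) ∈ F p.1) (n : ℕ) : Finite (ι n) := by
  have hsurj : Function.Surjective (Ideal.Quotient.mk A.coboundaries) :=
    Ideal.Quotient.mk_surjective
  have hAN : IsNoetherian A.cocycles A.Cohomology :=
    isNoetherian_of_surjective_ringHom (S := A.Cohomology) _ hsurj (by
      intro r x
      obtain ⟨x, rfl⟩ := hsurj x
      rfl)
  have hMN : IsNoetherian A.cocycles M.Cohomology := by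
    have : Module.Finite A.Cohomology M.Cohomology := hfg
    have : IsNoetherian A.Cohomology M.Cohomology := isNoetherian_of_isNoetherianRing_of_finite _ _
    refine isNoetherian_of_surjective_ringHom (S := A.Cohomology) _ hsurj ?_
    intro r x
    obtain ⟨x, rfl⟩ := Submodule.Quotient.mk_surjective _ x
    rfl
  -- In the inductive step, finiteness of level `n` is deduced from H(M/F n) and then feeds the
  -- exact sequence for H(M/F (n+1)).
  have key : ∀ n, IsNoetherian A.cocycles (((F n).restrictScalars A.cocycles).comap M.signedD ⧸
      (LinearMap.range M.signedD ⊔ (F n).restrictScalars A.cocycles).submoduleOf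
        (((F n).restrictScalars A.cocycles).comap M.signedD)) := by
    intro n
    induction n with
    | zero =>
      rw [hF.zero]
      exact isNoetherian_relative_cohomology_bot
    | succ n ih =>
      have := finite_of_relative_cohomology hA hmin b (hF.dgSubmodule n) (hFb n)
        fun j => hd ⟨n, j⟩
      have := isNoetherian_of_finite_step b (hF.dgSubmodule n) (hF.dgSubmodule (n + 1)) (hFb n)
        (hFb (n + 1)) fun j => hd ⟨n, j⟩
      exact isNoetherian_relative_cohomology M.signedD signedD_signedD
        (P := (F n).restrictScalars A.cocycles) (Q := (F (n + 1)).restrictScalars A.cocycles)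
        (hF.mono (Nat.le_succ n))
  have := key n
  exact finite_of_relative_cohomology hA hmin b (hF.dgSubmodule n) (hFb n) fun j => hd ⟨n, j⟩

/-- The levels serve as the decomposition of the semi-basis. A basis element lying in the span of
the levels below `N` is itself of level below `N`, so there are finitely many finite levels. -/
lemma finite_semiBasis_of_basis (hA : A.IsConnected) {ι : ℕ → Type u} [∀ n, Finite (ι n)]
    (b : Module.Basis (Σ n, ι n) A.carrier M.carrier)
    (hb : ∀ p, M.IsHomog (b p))
    (hd : ∀ p, M.d (b p) ∈ Submodule.span A.carrier (b '' {q | q.1 < p.1}))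
    {N : ℕ} (hN : Submodule.span A.carrier (b '' {p | p.1 < N}) = ⊤) :
    (Set.range b).Finite ∧ M.IsSemiBasis (Set.range b) := by
  have := hA.nontrivial
  refine ⟨?_, ?_, b.linearIndependent.linearIndepOn_id, b.span_eq, ?_⟩
  · have hlt : ∀ p : Σ n, ι n, p.1 < N := fun p => by
      have : b p ∈ Submodule.span A.carrier (b '' {p | p.1 < N}) := hN ▸ Submodule.mem_top
      rw [b.mem_span_image, b.repr_self, Finsupp.support_single _ one_ne_zero] at this
      exact this (Finset.mem_coe.2 (Finset.mem_singleton_self p))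
    have : Finite (Σ n, ι n) := Finite.of_injective
      (fun p => (⟨⟨p.1, hlt p⟩, p.2⟩ : Σ n : Fin N, ι n)) (by
        rintro ⟨m, i⟩ ⟨n, j⟩ h
        simp only [Sigma.mk.injEq, Fin.mk.injEq] at h
        obtain ⟨rfl, h⟩ := h
        rw [eq_of_heq h])
    exact Set.finite_range b
  · rintro _ ⟨p, rfl⟩
    exact hb p
  · refine ⟨fun u => b '' {p | p.1 = u}, ?_, ?_, ?_⟩
    · rw [← Set.image_iUnion, ← Set.image_univ]
      congr 1
      ext p
      simp
    · intro u v huv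
      refine (Set.disjoint_image_iff b.injective).2 (Set.disjoint_left.2 ?_)
      rintro p rfl h
      exact huv h
    · rintro _ _ ⟨p, rfl, rfl⟩
      convert hd p using 2
      rw [← Set.image_iUnion₂]
      congr 1
      ext q
      simp

lemma exists_filtration_of_dgFreeClass_lt_top (h : M.dgFreeClass < ⊤) :
    ∃ F, M.IsSemiFreeFiltration F ∧ ∃ n, F n = ⊤ := by
  obtain ⟨F, hF⟩ := iInf_lt_iff.1 h
  obtain ⟨⟨hF, -⟩, h⟩ := iInf_lt_iff.1 hF
  obtain ⟨n, h⟩ := iInf_lt_iff.1 h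
  obtain ⟨h, -⟩ := iInf_lt_iff.1 h
  -- `F` is indexed with a shift, so length at most `n` means that `F (n + 1)` is everything.
  exact ⟨F, hF, n + 1, h⟩

end DGModule

end DG

section DG

variable {k : Type u} [Field k] {A : DGAlgebra k}

namespace DGModule

variable {M N P : DGModule A}

/-! ### Quasi-isomorphisms in terms of elements -/

lemma quasiIso_iff (f : M ⟶ N) : quasiIso A f ↔
    (∀ x, M.d x = 0 → (∃ y, N.d y = f.toLin x) → ∃ z, M.d z = x) ∧
      ∀ y, N.d y = 0 → ∃ x z, M.d x = 0 ∧ y = f.toLin x + N.d z := by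
  refine and_congr ⟨fun h x hx ⟨y, hy⟩ => ?_, fun h => ?_⟩ ⟨fun h y hy => ?_, fun h y => ?_⟩
  · have h1 : cohomologyMap f (Submodule.Quotient.mk ⟨x, hx⟩) = cohomologyMap f 0 := by
      rw [map_zero]
      exact (Submodule.Quotient.mk_eq_zero N.coboundaries (x := cocyclesMap f ⟨x, hx⟩)).2 ⟨y, hy⟩
    exact (Submodule.Quotient.mk_eq_zero M.coboundaries).1 (h h1)
  · refine (injective_iff_map_eq_zero _).2 fun x hx => ?_
    obtain ⟨⟨x, hx'⟩, rfl⟩ := Submodule.Quotient.mk_surjective _ x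
    exact (Submodule.Quotient.mk_eq_zero _).2
      (h x hx' ((Submodule.Quotient.mk_eq_zero N.coboundaries (x := cocyclesMap f ⟨x, hx'⟩)).1 hx))
  · obtain ⟨x, hx⟩ := h (Submodule.Quotient.mk ⟨y, hy⟩)
    obtain ⟨⟨x, hx'⟩, rfl⟩ := Submodule.Quotient.mk_surjective _ x
    obtain ⟨z, hz⟩ := (Submodule.Quotient.eq N.coboundaries (x := ⟨y, hy⟩)
      (y := cocyclesMap f ⟨x, hx'⟩)).1 hx.symm
    refine ⟨x, z, hx', ?_⟩
    rw [hz]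
    exact (add_sub_cancel (f.toLin x) y).symm
  · obtain ⟨⟨y, hy⟩, rfl⟩ := Submodule.Quotient.mk_surjective _ y
    obtain ⟨x, z, hx, h⟩ := h y hy
    refine ⟨Submodule.Quotient.mk ⟨x, hx⟩, Eq.symm ((Submodule.Quotient.eq N.coboundaries
      (x := ⟨y, hy⟩) (y := cocyclesMap f ⟨x, hx⟩)).2 ⟨z, ?_⟩)⟩
    change N.d z = y - f.toLin x
    rw [h, add_sub_cancel_left]

/-- A DG module is acyclic if every cocycle is a coboundary. -/
def IsAcyclic (M : DGModule A) : Prop := ∀ x, M.d x = 0 → ∃ y, M.d y = x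

/-! ### The desuspension and the homotopy fibre -/

/-- The desuspension of `M`. The grading is shifted by one; the isomorphism `x ↦ (-1)^|x| x` allows
us to keep the action of `A` and the differential without any sign. -/
def desusp (M : DGModule A) : DGModule A where
  carrier := M.carrier
  gr i := M.gr (i - 1)
  decomposition := DirectSum.Decomposition.ofLinearMap (fun i => M.gr (i - 1))
    (DirectSum.toModule k ℤ _ (fun i => (DirectSum.lof k ℤ (fun i => M.gr (i - 1)) (i + 1)) ∘ₗ
      Submodule.inclusion (by rw [add_sub_cancel_right])) ∘ₗ
        (DirectSum.decomposeLinearEquiv M.gr).toLinearMap)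
    (by
      refine LinearMap.ext fun x => ?_
      change DirectSum.coeLinearMap (fun i => M.gr (i - 1))
        (DirectSum.toModule k ℤ _ _ (DirectSum.decompose M.gr x)) = x
      induction x using homog_induction with
      | zero => simp
      | homog i x hx =>
        rw [DirectSum.decompose_of_mem _ hx, ← DirectSum.lof_eq_of k, DirectSum.toModule_lof]
        change DirectSum.coeLinearMap (fun i => M.gr (i - 1)) (DirectSum.lof k ℤ _ _ _) = x
        rw [DirectSum.coeLinearMap_lof]
        rfl
      | add x y hx hy => rw [DirectSum.decompose_add, map_add, map_add, hx, hy])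
    (by
      refine DirectSum.linearMap_ext _ fun i => LinearMap.ext fun x => ?_
      change DirectSum.toModule k ℤ _ _ (DirectSum.decompose M.gr
          (DirectSum.coeLinearMap (fun i => M.gr (i - 1))
            (DirectSum.lof k ℤ (fun i => M.gr (i - 1)) i x))) =
        DirectSum.lof k ℤ (fun i => M.gr (i - 1)) i x
      rw [DirectSum.coeLinearMap_lof (fun i => M.gr (i - 1)), DirectSum.decompose_of_mem _ x.2,
        ← DirectSum.lof_eq_of k, DirectSum.toModule_lof]
      change DirectSum.lof k ℤ (fun i => M.gr (i - 1)) _ _ = _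
      rw [DirectSum.lof_eq_of, DirectSum.lof_eq_of]
      exact DFinsupp.single_eq_of_sigma_eq (Sigma.subtype_ext (sub_add_cancel i 1) rfl))
  smul_mem {i j a x} ha hx := by
    rw [add_sub_assoc]
    exact M.smul_mem ha hx
  d := M.d
  d_mem {i x} hx := by
    have := M.d_mem hx
    rwa [sub_add_cancel, ← add_sub_cancel_right i 1] at this
  d_d := M.d_d
  leibniz := M.leibniz

lemma sgn_mem {i : ℤ} {x : M.carrier} (hx : x ∈ M.gr i) : M.sgn x ∈ M.gr i := by
  rw [sgn_of_mem hx]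
  exact smul_units_mem _ hx

lemma d_sgn (x : M.carrier) : M.d (M.sgn x) = -M.sgn (M.d x) := by rw [sgn_d, neg_neg]

/-- `desusp` keeps the differential unsigned, so the sign sits in the cross term: `sgn ∘ f`
anticommutes with the differentials, which gives square zero. -/
lemma fib_d_d (f : M ⟶ N) (x : M.carrier) (y : N.carrier) :
    N.sgn (f.toLin (M.d x)) + N.d (N.sgn (f.toLin x) + N.d y) = 0 := by
  rw [f.comm, sgn_d, map_add, N.d_d, add_zero, neg_add_cancel]

lemma fib_leibniz (f : M ⟶ N) {i : ℤ} {a : A.carrier} (ha : a ∈ A.gr i) (x : M.carrier)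
    (y : N.carrier) : N.sgn (f.toLin (a • x)) + N.d (a • y) =
      A.d a • y + i.negOnePow • (a • (N.sgn (f.toLin x) + N.d y)) := by
  rw [map_smul, sgn_smul ha, N.leibniz ha, smul_add, smul_add]
  abel

lemma fib_d_mem (f : M ⟶ N) {i : ℤ} {x : M.carrier} {y : N.carrier} (hx : x ∈ M.gr i)
    (hy : y ∈ N.gr (i - 1)) : N.sgn (f.toLin x) + N.d y ∈ N.gr (i + 1 - 1) := by
  refine Submodule.add_mem _ ?_ (N.desusp.d_mem hy)
  rw [add_sub_cancel_right]
  exact sgn_mem (f.map_mem hx)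

/-- The homotopy fibre of a morphism `f : M ⟶ N`: the pairs `(x, y)` with differential
`d (x, y) = (d x, ± f x + d y)`. -/
def fib (f : M ⟶ N) : DGModule A where
  __ := prod M N.desusp
  d := LinearMap.prod (M.d ∘ₗ LinearMap.fst k M.carrier N.carrier)
    (N.sgn ∘ₗ f.toLin.restrictScalars k ∘ₗ LinearMap.fst k M.carrier N.carrier +
      N.d ∘ₗ LinearMap.snd k M.carrier N.carrier)
  d_mem hx := ⟨M.d_mem hx.1, fib_d_mem f hx.1 hx.2⟩
  d_d _ := Prod.ext (M.d_d _) (fib_d_d f _ _)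
  leibniz ha x := Prod.ext (M.leibniz ha x.1) (fib_leibniz f ha _ _)

/-- The projection of the homotopy fibre. -/
def fibFst (f : M ⟶ N) : fib f ⟶ M := ⟨LinearMap.fst _ _ _, fun h => h.1, fun _ => rfl⟩

/-- The map from the homotopy fibre of `f : M ⟶ N` to the homotopy fibre of the identity. -/
def fibToFibId (f : M ⟶ N) : fib f ⟶ fib (𝟙 N) :=
  ⟨LinearMap.prodMap f.toLin LinearMap.id, fun h => ⟨f.map_mem h.1, h.2⟩,
    fun x => Prod.ext (f.comm x.1) rfl⟩

/-- This factors the composite through the homotopy fibre of an identity, which is acyclic, so the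
composite vanishes in D(A). -/
lemma fibFst_comp (f : M ⟶ N) : fibFst f ≫ f = fibToFibId f ≫ fibFst (𝟙 N) := rfl

lemma isAcyclic_fib_id (N : DGModule A) : (fib (𝟙 N)).IsAcyclic := by
  intro p hp
  let x : N.carrier := p.1
  let y : N.carrier := p.2
  have h : N.sgn x = -N.d y := eq_neg_of_add_eq_zero_left (congrArg Prod.snd hp)
  have h1 : N.d (N.sgn y) = x := by
    rw [← sgn_sgn x, h, map_neg, sgn_d, neg_neg]
  have h2 : N.sgn (N.sgn y) + N.d 0 = y := by rw [sgn_sgn, map_zero, add_zero]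
  -- A cocycle `(x, y)` satisfies `sgn x = -d y`, hence `x = d (sgn y)`; the contracting homotopy
  -- sends `(x, y)` to `(sgn y, 0)`.
  exact ⟨((N.sgn y, 0) : N.carrier × N.carrier), Prod.ext h1 h2⟩

/-! ### The homotopy pullback of a quasi-isomorphism -/

/-- The homotopy fibre of `(f, -w) : M × N ⟶ P` is quasi-isomorphic to `M` when `w` is a
quasi-isomorphism. -/
lemma quasiIso_fibFst_fst (f : M ⟶ P) {w : N ⟶ P} (hw : quasiIso A w) :
    quasiIso A (fibFst ((prodBicone M N).fst ≫ f + -((prodBicone M N).snd ≫ w)) ≫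
      (prodBicone M N).fst) := by
  obtain ⟨h1, h2⟩ := (quasiIso_iff w).1 hw
  refine (quasiIso_iff _).2 ⟨?_, ?_⟩
  · intro q hq ⟨x', hx'⟩
    let x : M.carrier := q.1.1
    let y : N.carrier := q.1.2
    let z : P.carrier := q.2
    replace hx' : M.d x' = x := hx'
    have hy : N.d y = 0 := congrArg (fun q : (M.carrier × N.carrier) × P.carrier => q.1.2) hq
    have hz : P.sgn (f.toLin x + -w.toLin y) + P.d z = 0 :=
      congrArg (fun q : (M.carrier × N.carrier) × P.carrier => q.2) hq
    -- The cocycle condition reads `f x - w y = d (sgn z)`, and `x = d x'`, so `w y` is the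
    -- coboundary of `f x' - sgn z`.
    obtain ⟨y', hy'⟩ := h1 y hy ⟨f.toLin x' - P.sgn z, by
      have h3 := congrArg P.sgn (eq_neg_of_add_eq_zero_left hz)
      rw [sgn_sgn, map_neg, sgn_d, neg_neg] at h3
      rw [map_sub, ← h3, ← f.comm, hx']
      abel⟩
    have hu : P.d (f.toLin x' + -w.toLin y') = f.toLin x + -w.toLin y := by
      rw [map_add, map_neg, ← f.comm, ← w.comm, hx', hy']
    -- The pair `(x', y')` gives the right first components; the error in the last one is a cocycle
    -- up to sign, hence `w n` plus a coboundary. Replacing `y'` by `y' - n` absorbs it.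
    obtain ⟨n, p, hn, hp⟩ := h2 (P.sgn (z - P.sgn (f.toLin x' + -w.toLin y'))) (by
      rw [d_sgn, map_sub, d_sgn, hu, sub_neg_eq_add, add_comm, hz, map_zero, neg_zero])
    refine ⟨(((x', y' - n), -P.sgn p) : (M.carrier × N.carrier) × P.carrier), ?_⟩
    refine Prod.ext (Prod.ext hx' ?_) ?_
    · change N.d (y' - n) = y
      rw [map_sub, hn, sub_zero, hy']
    · change P.sgn (f.toLin x' + -w.toLin (y' - n)) + P.d (-P.sgn p) = z
      have h3 := congrArg P.sgn hp
      rw [sgn_sgn, map_add P.sgn (w.toLin n), sgn_d] at h3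
      have h4 : P.sgn (f.toLin x' + -w.toLin (y' - n)) =
          P.sgn (f.toLin x' + -w.toLin y') + P.sgn (w.toLin n) := by
        rw [← map_add P.sgn, map_sub]
        congr 1
        abel
      rw [h4, map_neg, sub_eq_iff_eq_add.1 h3]
      abel
  · intro x hx
    obtain ⟨y, z, hy, hz⟩ := h2 (f.toLin x) (by rw [← f.comm, hx, map_zero])
    refine ⟨(((x, y), P.sgn z) : (M.carrier × N.carrier) × P.carrier), 0, ?_, ?_⟩
    · refine Prod.ext (Prod.ext hx hy) ?_
      change P.sgn (f.toLin x + -w.toLin y) + P.d (P.sgn z) = 0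
      rw [hz, ← sub_eq_add_neg, add_sub_cancel_left, sgn_d, neg_add_cancel]
    · rw [map_zero, add_zero]
      rfl

/-- Adding the homotopy fibre of the identity of the target makes a quasi-isomorphism surjective. -/
lemma quasiIso_desc_fib_id {w : N ⟶ P} (hw : quasiIso A w) :
    quasiIso A ((prodBicone N (fib (𝟙 P))).fst ≫ w +
      (prodBicone N (fib (𝟙 P))).snd ≫ fibFst (𝟙 P)) := by
  obtain ⟨h1, h2⟩ := (quasiIso_iff w).1 hw
  refine (quasiIso_iff _).2 ⟨?_, ?_⟩
  · intro q hq ⟨p, hp⟩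
    let y : N.carrier := q.1
    let c : (fib (𝟙 P)).carrier := q.2
    have hy : N.d y = 0 := congrArg Prod.fst hq
    obtain ⟨c', hc'⟩ := isAcyclic_fib_id P c (congrArg Prod.snd hq)
    replace hp : P.d p = w.toLin y + (fibFst (𝟙 P)).toLin c := hp
    obtain ⟨y', hy'⟩ := h1 y hy ⟨p - (fibFst (𝟙 P)).toLin c', by
      rw [map_sub, hp, ← (fibFst (𝟙 P)).comm, hc', add_sub_cancel_right]⟩
    exact ⟨((y', c') : N.carrier × (fib (𝟙 P)).carrier), Prod.ext hy' hc'⟩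
  · intro y hy
    obtain ⟨x, z, hx, h⟩ := h2 y hy
    refine ⟨((x, 0) : N.carrier × (fib (𝟙 P)).carrier), z, Prod.ext hx (map_zero (fib (𝟙 P)).d), ?_⟩
    rw [h]
    change _ = w.toLin x + (fibFst (𝟙 P)).toLin 0 + _
    rw [map_zero, add_zero]

lemma surjective_desc_fib_id (w : N ⟶ P) : Function.Surjective
    ((prodBicone N (fib (𝟙 P))).fst ≫ w + (prodBicone N (fib (𝟙 P))).snd ≫ fibFst (𝟙 P)).toLin := by
  intro y
  refine ⟨((0, ((y, 0) : P.carrier × P.carrier)) : N.carrier × (fib (𝟙 P)).carrier), ?_⟩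
  change w.toLin 0 + y = y
  rw [map_zero, zero_add]

/-! ### Calculus in the derived category -/

instance : (quasiIso A).Q.Additive := LocAdd.Q_additive _

/-- For acyclic `N` the map from the zero module is a quasi-isomorphism, so it becomes invertible
and can be cancelled. -/
lemma Q_map_eq_zero_of_isAcyclic (hN : N.IsAcyclic) (f : N ⟶ P) : (quasiIso A).Q.map f = 0 := by
  have h0 : quasiIso A (0 : zeroModule A ⟶ N) := (quasiIso_iff _).2
    ⟨fun x _ _ => ⟨0, rfl⟩, fun y hy => by
      obtain ⟨z, hz⟩ := hN y hy
      exact ⟨0, z, rfl, by rw [hz, map_zero, zero_add]⟩⟩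
  have := Localization.inverts (quasiIso A).Q (quasiIso A) _ h0
  rw [← cancel_epi ((quasiIso A).Q.map (0 : zeroModule A ⟶ N)), ← Functor.map_comp, zero_comp,
    Functor.map_zero, comp_zero]

lemma Q_map_fibFst_id (N : DGModule A) : (quasiIso A).Q.map (fibFst (𝟙 N)) = 0 :=
  Q_map_eq_zero_of_isAcyclic (isAcyclic_fib_id N) _

lemma Q_map_fibFst_comp (f : M ⟶ N) : (quasiIso A).Q.map (fibFst f ≫ f) = 0 := by
  rw [fibFst_comp, Functor.map_comp, Q_map_fibFst_id, comp_zero]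

/-- Induction on the morphisms of the derived category. -/
lemma derivedCat_induction
    (R : ∀ M N : DGModule A, ((quasiIso A).Q.obj M ⟶ (quasiIso A).Q.obj N) → Prop)
    (map : ∀ (M N : DGModule A) (f : M ⟶ N), R M N ((quasiIso A).Q.map f))
    (inv : ∀ (M N : DGModule A) (w : M ⟶ N), quasiIso A w →
      ∀ ψ : (quasiIso A).Q.obj N ⟶ (quasiIso A).Q.obj M,
        (quasiIso A).Q.map w ≫ ψ = 𝟙 _ → ψ ≫ (quasiIso A).Q.map w = 𝟙 _ → R N M ψ)
    (comp : ∀ (M N P : DGModule A) (φ : (quasiIso A).Q.obj M ⟶ (quasiIso A).Q.obj N)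
      (ψ : (quasiIso A).Q.obj N ⟶ (quasiIso A).Q.obj P), R M N φ → R N P ψ → R M P (φ ≫ ψ))
    (M N : DGModule A) (ψ : (quasiIso A).Q.obj M ⟶ (quasiIso A).Q.obj N) : R M N ψ := by
  let R' : MorphismProperty (quasiIso A).Localization := fun X Y ψ => R X.as.obj Y.as.obj ψ
  have : R'.IsStableUnderComposition := ⟨fun φ ψ hφ hψ => comp _ _ _ φ ψ hφ hψ⟩
  have htop : R' = ⊤ := Localization.Construction.morphismProperty_eq_top _
    (fun X Y f => map X Y f)
    (fun X Y w hw => inv X Y w hw _ (Localization.Construction.wIso w hw).hom_inv_id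
      (Localization.Construction.wIso w hw).inv_hom_id)
  have h : R' ψ := by rw [htop]; trivial
  exact h

lemma quasiIso_comp {f : M ⟶ N} {g : N ⟶ P} (hf : quasiIso A f) (hg : quasiIso A g) :
    quasiIso A (f ≫ g) := by
  rw [quasiIso_eq] at hf hg ⊢
  exact MorphismProperty.comp_mem _ _ _ hf hg

/-- Every morphism of the derived category is a right fraction. -/
lemma exists_right_fraction (ψ : (quasiIso A).Q.obj M ⟶ (quasiIso A).Q.obj N) :
    ∃ (M' : DGModule A) (s : M' ⟶ M) (φ : M' ⟶ N), quasiIso A s ∧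
      (quasiIso A).Q.map s ≫ ψ = (quasiIso A).Q.map φ := by
  refine derivedCat_induction (fun M N ψ => ∃ (M' : DGModule A) (s : M' ⟶ M) (φ : M' ⟶ N),
    quasiIso A s ∧ (quasiIso A).Q.map s ≫ ψ = (quasiIso A).Q.map φ) ?_ ?_ ?_ M N ψ
  · intro M N f
    exact ⟨M, 𝟙 M, f, MorphismProperty.id_mem _ _, by
      rw [CategoryTheory.Functor.map_id, Category.id_comp]⟩
  · intro M N w hw ψ h _
    exact ⟨M, w, 𝟙 M, hw, by rw [h, CategoryTheory.Functor.map_id]⟩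
  · rintro M N P ψ₁ ψ₂ ⟨M₁, s₁, φ₁, hs₁, h₁⟩ ⟨M₂, s₂, φ₂, hs₂, h₂⟩
    -- The homotopy pullback of `φ₁` and `s₂` plays the role of the Ore square; it commutes only
    -- after passing to D(A), which is enough.
    have hp := Q_map_fibFst_comp ((prodBicone M₁ M₂).fst ≫ φ₁ + -((prodBicone M₁ M₂).snd ≫ s₂))
    have hq := quasiIso_fibFst_fst φ₁ hs₂
    generalize fibFst ((prodBicone M₁ M₂).fst ≫ φ₁ + -((prodBicone M₁ M₂).snd ≫ s₂)) = p at hp hq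
    rw [Preadditive.comp_add, Preadditive.comp_neg, Functor.map_add, Functor.map_neg,
      add_neg_eq_zero] at hp
    refine ⟨_, (p ≫ (prodBicone M₁ M₂).fst) ≫ s₁, p ≫ (prodBicone M₁ M₂).snd ≫ φ₂,
      quasiIso_comp hq hs₁, ?_⟩
    rw [Functor.map_comp, Category.assoc, reassoc_of% h₁, ← Functor.map_comp_assoc,
      Category.assoc, hp, ← Category.assoc p, Functor.map_comp_assoc, h₂, ← Functor.map_comp,
      Category.assoc]

end DGModule

end DG

section DG

variable {k : Type u} [Field k] {A : DGAlgebra k}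

namespace DGModule

variable {M N P : DGModule A}

/-! ### Lifting along surjective quasi-isomorphisms -/

lemma Hom.map_decompose (f : M ⟶ N) (x : M.carrier) (i : ℤ) :
    f.toLin (DirectSum.decompose M.gr x i) = DirectSum.decompose N.gr (f.toLin x) i := by
  induction x using homog_induction with
  | zero => simp
  | homog j x hx =>
    by_cases h : j = i
    · subst h
      rw [DirectSum.decompose_of_mem_same _ hx, DirectSum.decompose_of_mem_same _ (f.map_mem hx)]
    · rw [DirectSum.decompose_of_mem_ne _ hx h, DirectSum.decompose_of_mem_ne _ (f.map_mem hx) h,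
        map_zero]
  | add x y hx hy => simp only [DirectSum.decompose_add, DirectSum.add_apply, Submodule.coe_add,
      map_add, hx, hy]

lemma decompose_smul_of_mem {j : ℤ} {a : A.carrier} (ha : a ∈ A.gr j) (x : M.carrier) (i : ℤ) :
    (DirectSum.decompose M.gr (a • x) i : M.carrier) =
      a • (DirectSum.decompose M.gr x (i - j) : M.carrier) := by
  induction x using homog_induction with
  | zero => simp
  | homog l x hx =>
    by_cases h : l = i - j
    · subst h
      rw [DirectSum.decompose_of_mem_same _ hx, DirectSum.decompose_of_mem_same]
      have := M.smul_mem ha hx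
      rwa [add_sub_cancel] at this
    · rw [DirectSum.decompose_of_mem_ne _ hx h, smul_zero,
        DirectSum.decompose_of_mem_ne _ (M.smul_mem ha hx) (by omega)]
  | add x y hx hy => simp only [DirectSum.decompose_add, DirectSum.add_apply, Submodule.coe_add,
      smul_add, hx, hy]

/-- Along a surjective quasi-isomorphism, cochains with a prescribed differential can be lifted. -/
lemma exists_lift_of_surjective {π : M ⟶ N} (hπ : quasiIso A π)
    (hs : Function.Surjective π.toLin) {i : ℤ} {w : M.carrier} {x : N.carrier}
    (hw : w ∈ M.gr (i + 1)) (hx : x ∈ N.gr i) (hdw : M.d w = 0) (h : π.toLin w = N.d x) :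
    ∃ y ∈ M.gr i, M.d y = w ∧ π.toLin y = x := by
  obtain ⟨h1, h2⟩ := (quasiIso_iff π).1 hπ
  obtain ⟨y, hy, hyx⟩ : ∃ y, M.d y = w ∧ π.toLin y = x := by
    obtain ⟨y, rfl⟩ := hs x
    -- Starting from any preimage `y` of `x`, the error `w - d y` is a cocycle killed by `π`, hence
    -- some `d z`. Then `π z` is a cocycle, and `z` is corrected by a cocycle and a coboundary so
    -- that it maps to zero.
    obtain ⟨z, hz⟩ := h1 (w - M.d y) (by rw [map_sub, hdw, M.d_d, sub_zero])
      ⟨0, by rw [map_sub, π.comm, h, sub_self, map_zero]⟩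
    obtain ⟨c, x', hc, hx'⟩ := h2 (π.toLin z) (by
      rw [← π.comm, hz, map_sub, π.comm, h, sub_self])
    obtain ⟨y', rfl⟩ := hs x'
    refine ⟨y + (z - c - M.d y'), ?_, ?_⟩
    · rw [map_add, map_sub, map_sub, hc, M.d_d, sub_zero, sub_zero, hz, add_sub_cancel]
    · rw [map_add, map_sub, map_sub, hx', π.comm, add_sub_cancel_left, sub_self, add_zero]
  -- The degree-`i` component still works, since `d` and `π` respect components.
  refine ⟨DirectSum.decompose M.gr y i, SetLike.coe_mem _, ?_, ?_⟩
  · rw [← decompose_d, hy, DirectSum.decompose_of_mem_same _ hw]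
  · rw [Hom.map_decompose, hyx, DirectSum.decompose_of_mem_same _ hx]

lemma map_d_smul (g : M.carrier →ₗ[A.carrier] N.carrier) {x : M.carrier}
    (hx : g (M.d x) = N.d (g x)) (a : A.carrier) : g (M.d (a • x)) = N.d (g (a • x)) := by
  classical
  rw [← DirectSum.sum_support_decompose A.gr a, Finset.sum_smul]
  simp only [map_sum]
  refine Finset.sum_congr rfl fun i _ => ?_
  have hi := SetLike.coe_mem (DirectSum.decompose A.gr a i)
  rw [map_smul g, M.leibniz hi, N.leibniz hi, map_add, map_smul, Units.smul_def, Units.smul_def,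
    map_zsmul, map_smul, hx]

lemma map_d_of_mem_span (g : M.carrier →ₗ[A.carrier] N.carrier) {S : Set M.carrier}
    (hS : ∀ x ∈ S, g (M.d x) = N.d (g x)) {x : M.carrier} (hx : x ∈ Submodule.span A.carrier S) :
    g (M.d x) = N.d (g x) := by
  refine Submodule.span_induction (p := fun x _ => g (M.d x) = N.d (g x)) hS ?_ ?_ ?_ hx
  · simp
  · intro x y _ _ hx hy
    simp only [map_add, hx, hy]
  · intro a x _ hx
    exact map_d_smul g hx a

lemma map_mem_of_mem_span (g : M.carrier →ₗ[A.carrier] N.carrier) {S : Set M.carrier}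
    (hS : ∀ x ∈ S, ∃ i, x ∈ M.gr i ∧ g x ∈ N.gr i) {x : M.carrier}
    (hx : x ∈ Submodule.span A.carrier S) {i : ℤ} (hxi : x ∈ M.gr i) : g x ∈ N.gr i := by
  classical
  -- An element of the span is a sum of non-homogeneous terms in general, so the induction runs on
  -- all components at once.
  suffices h : ∀ i, g (DirectSum.decompose M.gr x i) ∈ N.gr i by
    have := h i
    rwa [DirectSum.decompose_of_mem_same _ hxi] at this
  clear hxi
  refine Submodule.span_induction
    (p := fun x _ => ∀ i, g (DirectSum.decompose M.gr x i) ∈ N.gr i) ?_ ?_ ?_ ?_ hx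
  · intro x hx i
    obtain ⟨j, hj, hgj⟩ := hS x hx
    by_cases h : j = i
    · subst h
      rwa [DirectSum.decompose_of_mem_same _ hj]
    · rw [DirectSum.decompose_of_mem_ne _ hj h, map_zero]
      exact Submodule.zero_mem _
  · intro i
    simp
  · intro x y _ _ hx hy i
    rw [DirectSum.decompose_add, DirectSum.add_apply, Submodule.coe_add, map_add]
    exact Submodule.add_mem _ (hx i) (hy i)
  · intro a x _ hx i
    rw [← DirectSum.sum_support_decompose A.gr a, Finset.sum_smul, DirectSum.decompose_sum,
      DFinsupp.finsetSum_apply, AddSubmonoidClass.coe_finsetSum, map_sum]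
    refine Submodule.sum_mem _ fun j _ => ?_
    have hj := SetLike.coe_mem (DirectSum.decompose A.gr a j)
    rw [decompose_smul_of_mem hj, map_smul]
    have := N.smul_mem hj (hx (i - j))
    rwa [add_sub_cancel] at this

/-- The lift is built level by level: the differential of a basis element involves only lower
levels, where the lift is already a chain map, so the surjective quasi-isomorphism supplies its
value. -/
lemma exists_lift_of_basis {ι : ℕ → Type u}
    (b : Module.Basis (Σ n, ι n) A.carrier M.carrier) (hb : ∀ p, M.IsHomog (b p))
    (hd : ∀ p, M.d (b p) ∈ Submodule.span A.carrier (b '' {q | q.1 < p.1}))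
    {n : ℕ} (hn : Submodule.span A.carrier (b '' {p | p.1 < n}) = ⊤)
    {π : N ⟶ P} (hπ : quasiIso A π) (hs : Function.Surjective π.toLin) (f : M ⟶ P) :
    ∃ g : M ⟶ N, g ≫ π = f := by
  classical
  choose deg hdeg using hb
  have hb' : ∀ (v : (Σ n, ι n) → N.carrier) p, b.constr ℤ v (b p) = v p :=
    fun v p => b.constr_basis ℤ v p
  -- The family `v` is defined on the whole basis but constrained only below level `n`; its values
  -- elsewhere are irrelevant.
  have key : ∀ n : ℕ, ∃ v : (Σ n, ι n) → N.carrier, ∀ p, p.1 < n → v p ∈ N.gr (deg p) ∧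
      b.constr ℤ v (M.d (b p)) = N.d (v p) ∧ π.toLin (v p) = f.toLin (b p) := by
    intro n
    induction n with
    | zero => exact ⟨0, fun p hp => (Nat.not_lt_zero _ hp).elim⟩
    | succ n ih =>
      obtain ⟨v, hv⟩ := ih
      have hy : ∀ p, p.1 = n → ∃ y ∈ N.gr (deg p), N.d y = b.constr ℤ v (M.d (b p)) ∧
          π.toLin y = f.toLin (b p) := by
        rintro p rfl
        refine exists_lift_of_surjective hπ hs ?_ (f.map_mem (hdeg p)) ?_ ?_
        · refine map_mem_of_mem_span _ ?_ (hd p) (M.d_mem (hdeg p))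
          rintro _ ⟨q, hq, rfl⟩
          exact ⟨deg q, hdeg q, by rw [hb']; exact (hv q hq).1⟩
        · rw [← map_d_of_mem_span _ _ (hd p), M.d_d, map_zero]
          rintro _ ⟨q, hq, rfl⟩
          rw [hb', (hv q hq).2.1]
        · rw [← f.comm]
          refine LinearMap.eqOn_span' (f := π.toLin ∘ₗ b.constr ℤ v) (g := f.toLin) ?_ (hd p)
          rintro _ ⟨q, hq, rfl⟩
          rw [LinearMap.comp_apply, hb', (hv q hq).2.2]
      choose! y hy using hy
      let v' : (Σ n, ι n) → N.carrier := fun p => if p.1 = n then y p else v p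
      -- Changing `v` at level `n` does not affect the image of `d (b p)` for `p.1 ≤ n`, which
      -- involves only levels below `p.1`.
      have hagree : ∀ p, p.1 ≤ n → b.constr ℤ v' (M.d (b p)) = b.constr ℤ v (M.d (b p)) := by
        intro p hp
        refine LinearMap.eqOn_span' (f := b.constr ℤ v') (g := b.constr ℤ v) ?_ (hd p)
        rintro _ ⟨q, hq, rfl⟩
        rw [hb', hb']
        exact if_neg (ne_of_lt (lt_of_lt_of_le hq hp))
      refine ⟨v', fun p hp => ?_⟩
      rw [hagree p (Nat.le_of_lt_succ hp)]
      by_cases h : p.1 = n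
      · rw [show v' p = y p from if_pos h]
        obtain ⟨h1, h2, h3⟩ := hy p h
        exact ⟨h1, h2.symm, h3⟩
      · rw [show v' p = v p from if_neg h]
        exact hv p (lt_of_le_of_ne (Nat.le_of_lt_succ hp) h)
  obtain ⟨v, hv⟩ := key n
  have htop : ∀ x, x ∈ Submodule.span A.carrier (b '' {p | p.1 < n}) := fun x => hn ▸ trivial
  refine ⟨⟨b.constr ℤ v, fun {i x} hx => map_mem_of_mem_span _ ?_ (htop x) hx,
    fun x => map_d_of_mem_span _ ?_ (htop x)⟩, DGModule.hom_ext fun x => ?_⟩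
  · rintro _ ⟨q, hq, rfl⟩
    exact ⟨deg q, hdeg q, by rw [hb']; exact (hv q hq).1⟩
  · rintro _ ⟨q, hq, rfl⟩
    rw [hb', (hv q hq).2.1]
  · refine LinearMap.eqOn_span' (f := π.toLin ∘ₗ b.constr ℤ v) (g := f.toLin) ?_ (htop x)
    rintro _ ⟨q, hq, rfl⟩
    rw [LinearMap.comp_apply, hb', (hv q hq).2.2]

/-- If `M` has the lifting property against surjective quasi-isomorphisms, then every morphism of
the derived category out of `M` is represented by a morphism of DG modules. -/
lemma Q_map_surjective_of_lift
    (hM : ∀ (N P : DGModule A) (π : N ⟶ P), quasiIso A π → Function.Surjective π.toLin →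
      ∀ f : M ⟶ P, ∃ g : M ⟶ N, g ≫ π = f)
    (ψ : (quasiIso A).Q.obj M ⟶ (quasiIso A).Q.obj N) : ∃ g, (quasiIso A).Q.map g = ψ := by
  suffices h : ∀ f : M ⟶ M, ∃ g, (quasiIso A).Q.map f ≫ ψ = (quasiIso A).Q.map g by
    obtain ⟨g, hg⟩ := h (𝟙 M)
    rw [CategoryTheory.Functor.map_id, Category.id_comp] at hg
    exact ⟨g, hg.symm⟩
  refine derivedCat_induction (fun N P ψ => ∀ f : M ⟶ N, ∃ g,
    (quasiIso A).Q.map f ≫ ψ = (quasiIso A).Q.map g) ?_ ?_ ?_ M N ψ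
  · intro N P φ f
    exact ⟨f ≫ φ, ((quasiIso A).Q.map_comp f φ).symm⟩
  · intro N P w hw ψ h _ f
    -- `w` becomes surjective after adding a contractible summand to its source; the extra term in
    -- the lift vanishes in D(A).
    obtain ⟨g, rfl⟩ := hM _ _ _ (quasiIso_desc_fib_id hw) (surjective_desc_fib_id w) f
    refine ⟨g ≫ (prodBicone N (fib (𝟙 P))).fst, ?_⟩
    rw [Preadditive.comp_add, Functor.map_add, ← Category.assoc, ← Category.assoc,
      Functor.map_comp _ _ (fibFst _), Q_map_fibFst_id, comp_zero, add_zero, Functor.map_comp _ _ w,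
      Category.assoc, h, Category.comp_id]
  · intro N P S φ ψ hφ hψ f
    obtain ⟨g, hg⟩ := hφ f
    obtain ⟨l, hl⟩ := hψ g
    exact ⟨l, by rw [← Category.assoc, hg, hl]⟩

end DGModule

end DG

/-! ### Coproducts and the functor Hom(G, -). -/

/-- A criterion for `Hom(G, -)` to preserve a coproduct. -/
lemma nonempty_isColimit_preadditiveCoyoneda {D : Type*} [Category D] [Preadditive D] {J : Type*}
    {G : D} {K : Discrete J ⥤ D} (c : Cocone K)
    (hinj : ∀ (s : Finset J) (a : ∀ j, G ⟶ K.obj ⟨j⟩), ∑ j ∈ s, a j ≫ c.ι.app ⟨j⟩ = 0 →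
      ∀ j ∈ s, a j = 0)
    (hsurj : ∀ f : G ⟶ c.pt, ∃ (s : Finset J) (a : ∀ j, G ⟶ K.obj ⟨j⟩),
      ∑ j ∈ s, a j ≫ c.ι.app ⟨j⟩ = f) :
    Nonempty (IsColimit ((preadditiveCoyoneda.obj (Opposite.op G)).mapCocone c)) := by
  classical
  -- The two hypotheses say that `Φ` is an isomorphism from the algebraic direct sum of the groups
  -- Hom(G, K j), whose universal property is then transported.
  let Φ : (Π₀ j, (G ⟶ K.obj ⟨j⟩)) →+ (G ⟶ c.pt) :=
    DFinsupp.sumAddHom fun j => Preadditive.rightComp G (c.ι.app ⟨j⟩)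
  have hΦ : ∀ x, Φ x = ∑ j ∈ x.support, x j ≫ c.ι.app ⟨j⟩ := fun x => DFinsupp.sumAddHom_apply _ _
  have hΦ' : ∀ j x, Φ (DFinsupp.single j x) = x ≫ c.ι.app ⟨j⟩ :=
    fun j x => DFinsupp.sumAddHom_single _ _ _
  have hbij : Function.Bijective Φ := by
    refine ⟨(injective_iff_map_eq_zero _).2 fun x hx => ?_, fun f => ?_⟩
    · rw [hΦ] at hx
      refine DFinsupp.ext fun j => ?_
      by_cases hj : j ∈ x.support
      · exact hinj _ _ hx j hj
      · exact DFinsupp.notMem_support_iff.1 hj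
    · obtain ⟨s, a, h⟩ := hsurj f
      refine ⟨∑ j ∈ s, DFinsupp.single j (a j), ?_⟩
      rw [map_sum, ← h]
      exact Finset.sum_congr rfl fun j _ => hΦ' j (a j)
  let e := AddEquiv.ofBijective Φ hbij
  have he : ∀ j x, e.symm (x ≫ c.ι.app ⟨j⟩) = DFinsupp.single j x := fun j x =>
    e.symm_apply_eq.2 (hΦ' j x).symm
  let ψ (s : Cocone (K ⋙ preadditiveCoyoneda.obj (Opposite.op G))) (j : J) :
      (G ⟶ K.obj ⟨j⟩) →+ s.pt := (s.ι.app ⟨j⟩).hom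
  refine ⟨⟨fun s => AddCommGrpCat.ofHom (AddMonoidHom.comp (M := (G ⟶ c.pt)) (P := s.pt)
    (DFinsupp.sumAddHom (ψ s)) e.symm.toAddMonoidHom), fun s ⟨j⟩ => ?_, fun s m hm => ?_⟩⟩
  · refine AddCommGrpCat.hom_ext (AddMonoidHom.ext fun (x : G ⟶ K.obj ⟨j⟩) => ?_)
    change DFinsupp.sumAddHom (ψ s) (e.symm (x ≫ c.ι.app ⟨j⟩)) = ψ s j x
    rw [he, DFinsupp.sumAddHom_single]
  · refine AddCommGrpCat.hom_ext (AddMonoidHom.ext fun (f : G ⟶ c.pt) => ?_)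
    let m' : (G ⟶ c.pt) →+ s.pt := m.hom
    change m' f = DFinsupp.sumAddHom (ψ s) (e.symm f)
    obtain ⟨t, a, rfl⟩ := hsurj f
    rw [map_sum, map_sum, map_sum]
    refine Finset.sum_congr rfl fun j _ => ?_
    rw [he, DFinsupp.sumAddHom_single]
    exact congrArg (fun h => AddCommGrpCat.Hom.hom h (a j)) (hm ⟨j⟩)

section DG

variable {k : Type u} [Field k] {A : DGAlgebra k}

namespace DGModule

/-! ### Direct sums -/

section DirectSum

variable {J : Type u} (M : J → DGModule A) {N : DGModule A}

/-- The homogeneous pieces of the direct sum of a family of DG modules. -/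
def directSumGr (i : ℤ) : Submodule k (Π₀ j, (M j).carrier) :=
  ⨅ j, ((M j).gr i).comap (DFinsupp.lapply j)

variable {M} in
lemma mem_directSumGr {i : ℤ} {x : Π₀ j, (M j).carrier} :
    x ∈ directSumGr M i ↔ ∀ j, x j ∈ (M j).gr i := by
  simp [directSumGr, Submodule.mem_iInf]

open scoped Classical in
/-- The inclusion of a summand, on homogeneous components. -/
noncomputable def directSumInclGr (i : ℤ) (j : J) : (M j).gr i →ₗ[k] directSumGr M i :=
  (DFinsupp.lsingle (R := k) (M := fun j => (M j).carrier) j).restrict fun x hx =>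
    mem_directSumGr.2 fun l => by
      rw [DFinsupp.lsingle_apply]
      by_cases h : j = l
      · subst h
        rwa [DFinsupp.single_eq_same]
      · rw [DFinsupp.single_eq_of_ne (Ne.symm h)]
        exact Submodule.zero_mem _

open scoped Classical in
lemma coe_directSumInclGr (i : ℤ) (j : J) (x : (M j).gr i) :
    (directSumInclGr M i j x : Π₀ j, (M j).carrier) = DFinsupp.single j (x : (M j).carrier) := rfl

/-- The decomposition of the direct sum into homogeneous pieces. -/
noncomputable instance directSumDecomposition : DirectSum.Decomposition (directSumGr M) := by
  classical
  exact DirectSum.Decomposition.ofLinearMap _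
    (DFinsupp.lsum ℕ fun j => DirectSum.lmap (fun i => directSumInclGr M i j) ∘ₗ
      (DirectSum.decomposeLinearEquiv (M j).gr).toLinearMap)
    (by
      refine DFinsupp.lhom_ext' fun j => LinearMap.ext fun x => ?_
      rw [LinearMap.comp_apply, LinearMap.comp_apply, DFinsupp.lsingle_apply, LinearMap.id_comp,
        DFinsupp.lsum_single, DFinsupp.lsingle_apply]
      change DirectSum.coeLinearMap _ (DirectSum.lmap _ (DirectSum.decompose (M j).gr x)) = _
      induction x using homog_induction with
      | zero => simp
      | homog i x hx =>
        rw [DirectSum.decompose_of_mem _ hx, DirectSum.lmap_of, DirectSum.coeLinearMap_of,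
          coe_directSumInclGr]
      | add x y hx hy => rw [DirectSum.decompose_add, map_add, map_add, hx, hy,
          DFinsupp.single_add])
    (by
      refine DirectSum.linearMap_ext _ fun i => LinearMap.ext fun x => ?_
      rw [LinearMap.comp_apply, LinearMap.comp_apply, LinearMap.id_comp,
        DirectSum.coeLinearMap_lof, DFinsupp.lsum_apply_apply, DFinsupp.sumAddHom_apply,
        DFinsupp.sum]
      have h : ∀ j, DirectSum.lmap (fun i => directSumInclGr M i j)
          (DirectSum.decompose (M j).gr ((x : Π₀ j, (M j).carrier) j)) =
            DirectSum.lof k ℤ _ i (directSumInclGr M i j ⟨(x : Π₀ j, (M j).carrier) j,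
              mem_directSumGr.1 x.2 j⟩) := fun j => by
        rw [DirectSum.decompose_of_mem _ (mem_directSumGr.1 x.2 j), DirectSum.lmap_of,
          DirectSum.lof_eq_of]
      refine (Finset.sum_congr rfl fun j _ => h j).trans ?_
      rw [← map_sum]
      congr 1
      refine Subtype.ext ?_
      rw [AddSubmonoidClass.coe_finsetSum]
      convert DFinsupp.sum_single (f := (x : Π₀ j, (M j).carrier)) using 1
      rw [DFinsupp.sum]
      refine Finset.sum_congr rfl fun j _ => ?_
      rw [coe_directSumInclGr])

/-- The direct sum of a family of DG modules. -/
noncomputable def directSum : DGModule A where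
  carrier := Π₀ j, (M j).carrier
  gr := directSumGr M
  smul_mem ha hx := mem_directSumGr.2 fun j => (M j).smul_mem ha (mem_directSumGr.1 hx j)
  d := DFinsupp.mapRange.linearMap fun j => (M j).d
  d_mem hx := mem_directSumGr.2 fun j => (M j).d_mem (mem_directSumGr.1 hx j)
  d_d x := DFinsupp.ext fun j => (M j).d_d (x j)
  leibniz ha x := DFinsupp.ext fun j => (M j).leibniz ha (x j)

open scoped Classical in
/-- The inclusion of a summand. -/
noncomputable def directSumIncl (j : J) : M j ⟶ directSum M where
  toLin := DFinsupp.lsingle (R := A.carrier) (M := fun j => (M j).carrier) j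
  map_mem {i x} hx := (directSumInclGr M i j ⟨x, hx⟩).2
  comm _ := (DFinsupp.mapRange_single (f := fun j => (M j).d)
    (hf := fun j => map_zero (M j).d)).symm

/-- The projection onto a summand. -/
noncomputable def directSumProj (j : J) : directSum M ⟶ M j where
  toLin := (DFinsupp.lapply j : (Π₀ j, (M j).carrier) →ₗ[A.carrier] _)
  map_mem {_ _} hx := mem_directSumGr.1 hx j
  comm _ := rfl

lemma directSumIncl_proj_self (j : J) : directSumIncl M j ≫ directSumProj M j = 𝟙 _ :=
  DGModule.hom_ext fun x => by
    classical
    exact DFinsupp.single_eq_same (β := fun j => (M j).carrier) (i := j) (b := x)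

lemma directSumIncl_proj_ne {j l : J} (h : j ≠ l) :
    directSumIncl M j ≫ directSumProj M l = 0 :=
  DGModule.hom_ext fun x => by
    classical
    exact DFinsupp.single_eq_of_ne (β := fun j => (M j).carrier) (i := j) (b := x) h.symm

variable {M}

lemma directSum_ext {x y : (directSum M).carrier}
    (h : ∀ j, (directSumProj M j).toLin x = (directSumProj M j).toLin y) : x = y :=
  DFinsupp.ext h

open scoped Classical in
/-- A finitely supported family with components `f j`, `j ∈ s`. -/
noncomputable def directSumMk (s : Finset J) (f : ∀ j, (M j).carrier) : (directSum M).carrier :=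
  DFinsupp.mk (β := fun j => (M j).carrier) s fun j => f j

lemma directSumProj_mk (s : Finset J) (f : ∀ j, (M j).carrier) (hf : ∀ j, j ∉ s → f j = 0) (j : J) :
    (directSumProj M j).toLin (directSumMk s f) = f j := by
  classical
  refine (DFinsupp.mk_apply (β := fun j => (M j).carrier) (s := s)
    (x := fun j : (s : Set J) => f j)).trans ?_
  split_ifs with h
  · rfl
  · exact (hf j h).symm

lemma exists_finset_directSumProj (x : (directSum M).carrier) :
    ∃ s : Finset J, ∀ j, j ∉ s → (directSumProj M j).toLin x = 0 := by
  classical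
  exact ⟨DFinsupp.support (β := fun j => (M j).carrier) x,
    fun j hj => DFinsupp.notMem_support_iff.1 hj⟩

/-- Families chosen componentwise assemble into an element of the direct sum when they vanish
wherever a given element does. -/
lemma exists_directSum_eq (x : (directSum M).carrier) (f : ∀ j, (M j).carrier)
    (hf : ∀ j, (directSumProj M j).toLin x = 0 → f j = 0) :
    ∃ y : (directSum M).carrier, ∀ j, (directSumProj M j).toLin y = f j := by
  obtain ⟨s, hs⟩ := exists_finset_directSumProj x
  exact ⟨directSumMk s f, directSumProj_mk s f fun j hj => hf j (hs j hj)⟩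

open scoped Classical in
/-- The morphism out of a direct sum with the given components. -/
noncomputable def directSumDesc (f : ∀ j, M j ⟶ N) : directSum M ⟶ N where
  toLin := (DFinsupp.lsum ℕ fun j => (f j).toLin : (Π₀ j, (M j).carrier) →ₗ[A.carrier] N.carrier)
  map_mem {i} := by
    intro (x : Π₀ j, (M j).carrier) hx
    change DFinsupp.lsum ℕ (fun j => (f j).toLin) x ∈ _
    rw [DFinsupp.lsum_apply_apply, DFinsupp.sumAddHom_apply]
    exact Submodule.sum_mem _ fun j _ => (f j).map_mem (mem_directSumGr.1 hx j)
  comm := by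
    intro (x : Π₀ j, (M j).carrier)
    change DFinsupp.lsum ℕ (fun j => (f j).toLin) (DFinsupp.mapRange.linearMap (fun j => (M j).d) x)
      = N.d (DFinsupp.lsum ℕ (fun j => (f j).toLin) x)
    induction x using DFinsupp.induction with
    | h0 => simp
    | ha j b x _ _ ih =>
      rw [map_add, map_add, map_add, map_add, ih, DFinsupp.mapRange.linearMap_apply,
        DFinsupp.mapRange_single, DFinsupp.lsum_single, DFinsupp.lsum_single, (f j).comm]

lemma directSumIncl_desc (f : ∀ j, M j ⟶ N) (j : J) : directSumIncl M j ≫ directSumDesc f = f j :=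
  DGModule.hom_ext fun x => by
    classical
    exact DFinsupp.lsum_single ℕ (fun j => (f j).toLin) j x

/-- The direct sum of a family of morphisms. -/
noncomputable def directSumMap {M' : J → DGModule A} (f : ∀ j, M' j ⟶ M j) :
    directSum M' ⟶ directSum M where
  toLin := (DFinsupp.mapRange.linearMap fun j => (f j).toLin :
    (Π₀ j, (M' j).carrier) →ₗ[A.carrier] Π₀ j, (M j).carrier)
  map_mem hx := mem_directSumGr.2 fun j => (f j).map_mem (mem_directSumGr.1 hx j)
  comm x := DFinsupp.ext fun j => (f j).comm ((directSumProj M' j).toLin x)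

lemma directSumIncl_map {M' : J → DGModule A} (f : ∀ j, M' j ⟶ M j) (j : J) :
    directSumIncl M' j ≫ directSumMap f = f j ≫ directSumIncl M j :=
  DGModule.hom_ext fun x => by
    classical
    exact DFinsupp.mapRange_single (f := fun j => (f j).toLin)
      (hf := fun j => map_zero (f j).toLin)

/-- The criterion `quasiIso_iff` is solved in each component, choosing zero wherever the given
cocycle is zero so that the solutions have finite support. -/
lemma quasiIso_directSumMap {M' : J → DGModule A} {f : ∀ j, M' j ⟶ M j}
    (hf : ∀ j, quasiIso A (f j)) : quasiIso A (directSumMap f) := by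
  classical
  have h1 := fun j => ((quasiIso_iff (f j)).1 (hf j)).1
  have h2 := fun j => ((quasiIso_iff (f j)).1 (hf j)).2
  have hproj : ∀ (M : J → DGModule A) (j : J) (x : (directSum M).carrier),
      (directSumProj M j).toLin ((directSum M).d x) = (M j).d ((directSumProj M j).toLin x) :=
    fun _ _ _ => rfl
  have hmap : ∀ (j : J) (x : (directSum M').carrier),
      (directSumProj M j).toLin ((directSumMap f).toLin x) =
        (f j).toLin ((directSumProj M' j).toLin x) := fun _ _ => rfl
  refine (quasiIso_iff _).2 ⟨fun x hx ⟨y, hy⟩ => ?_, fun y hy => ?_⟩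
  · have key : ∀ j, ∃ z, (M' j).d z = (directSumProj M' j).toLin x ∧
        ((directSumProj M' j).toLin x = 0 → z = 0) := fun j => by
      by_cases h0 : (directSumProj M' j).toLin x = 0
      · exact ⟨0, by rw [h0, map_zero], fun _ => rfl⟩
      · obtain ⟨z, hz⟩ := h1 j _ (by rw [← hproj, hx, map_zero])
          ⟨(directSumProj M j).toLin y, by rw [← hproj, hy, hmap]⟩
        exact ⟨z, hz, fun h => (h0 h).elim⟩
    choose z hz hz0 using key
    obtain ⟨w, hw⟩ := exists_directSum_eq x z hz0
    exact ⟨w, directSum_ext fun j => by rw [hproj, hw, hz]⟩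
  · have key : ∀ j, ∃ x z, (M' j).d x = 0 ∧
        (directSumProj M j).toLin y = (f j).toLin x + (M j).d z ∧
          ((directSumProj M j).toLin y = 0 → x = 0 ∧ z = 0) := fun j => by
      by_cases h0 : (directSumProj M j).toLin y = 0
      · exact ⟨0, 0, map_zero _, by rw [h0, map_zero, map_zero, add_zero], fun _ => ⟨rfl, rfl⟩⟩
      · obtain ⟨x, z, hx, h⟩ := h2 j _ (by rw [← hproj, hy, map_zero])
        exact ⟨x, z, hx, h, fun h => (h0 h).elim⟩
    choose x z hx hxz h0 using key
    obtain ⟨z', hz'⟩ := exists_directSum_eq y z fun j h => (h0 j h).2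
    obtain ⟨s, hs⟩ := exists_finset_directSumProj y
    have hx' := directSumProj_mk s x fun j hj => (h0 j (hs j hj)).1
    refine ⟨directSumMk s x, z', directSum_ext fun j => ?_, directSum_ext fun j => ?_⟩
    · rw [hproj, hx', hx, map_zero]
    · rw [map_add, hproj, hmap, hx', hz', hxz]

/-- Morphisms out of the summands in the derived category come from a morphism out of the direct
sum. -/
lemma exists_directSum_desc_derivedCat
    (ψ : ∀ j, (quasiIso A).Q.obj (M j) ⟶ (quasiIso A).Q.obj N) :
    ∃ Ψ : (quasiIso A).Q.obj (directSum M) ⟶ (quasiIso A).Q.obj N,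
      ∀ j, (quasiIso A).Q.map (directSumIncl M j) ≫ Ψ = ψ j := by
  -- The denominators of all the fractions add up to a single quasi-isomorphism of direct sums,
  -- which is inverted in D(A).
  choose M' s φ hs h using fun j => exists_right_fraction (ψ j)
  have hS := Localization.inverts (quasiIso A).Q (quasiIso A) _ (quasiIso_directSumMap hs)
  refine ⟨inv ((quasiIso A).Q.map (directSumMap s)) ≫ (quasiIso A).Q.map (directSumDesc φ),
    fun j => ?_⟩
  have := Localization.inverts (quasiIso A).Q (quasiIso A) _ (hs j)
  rw [← cancel_epi ((quasiIso A).Q.map (s j)), h j, ← Functor.map_comp_assoc, ← directSumIncl_map,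
    Functor.map_comp_assoc, IsIso.hom_inv_id_assoc, ← Functor.map_comp, directSumIncl_desc]

/-- A morphism from a finitely generated DG module to a direct sum factors through a finite
subsum. -/
lemma eq_sum_of_finite {G : DGModule A} {E : Set G.carrier} (hE : E.Finite)
    (hspan : Submodule.span A.carrier E = ⊤) (g : G ⟶ directSum M) :
    ∃ s : Finset J, g = ∑ j ∈ s, g ≫ directSumProj M j ≫ directSumIncl M j := by
  classical
  choose t ht using fun x => exists_finset_directSumProj (g.toLin x)
  let s := hE.toFinset.biUnion t
  have hs : ∀ j, j ∉ s → g ≫ directSumProj M j = 0 := fun j hj => DGModule.hom_ext fun x => by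
    refine LinearMap.eqOn_span' (f := (g ≫ directSumProj M j).toLin) (g := 0) (s := E) ?_
      (hspan ▸ Submodule.mem_top)
    intro e he
    exact ht e j fun h => hj (Finset.mem_biUnion.2 ⟨e, hE.mem_toFinset.2 he, h⟩)
  refine ⟨s, ?_⟩
  suffices h : ∀ l, g ≫ directSumProj M l =
      (∑ j ∈ s, g ≫ directSumProj M j ≫ directSumIncl M j) ≫ directSumProj M l from
    DGModule.hom_ext fun x => directSum_ext fun l => congrArg (fun f => Hom.toLin f x) (h l)
  intro l
  rw [Preadditive.sum_comp, Finset.sum_eq_single l]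
  · rw [Category.assoc, Category.assoc, directSumIncl_proj_self, Category.comp_id]
  · intro j _ hj
    rw [Category.assoc, Category.assoc, directSumIncl_proj_ne M hj, comp_zero, comp_zero]
  · intro hl
    rw [← Category.assoc, hs l hl, zero_comp, zero_comp]

end DirectSum

/-! ### Compactness -/

/-- A DG module with a finite generating set and the lifting property against surjective
quasi-isomorphisms is compact. -/
lemma isCompact_of_lift {G : DGModule A} {E : Set G.carrier} (hE : E.Finite)
    (hspan : Submodule.span A.carrier E = ⊤)
    (hG : ∀ (N P : DGModule A) (π : N ⟶ P), quasiIso A π → Function.Surjective π.toLin →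
      ∀ f : G ⟶ P, ∃ g : G ⟶ N, g ≫ π = f) : G.IsCompact := by
  intro J
  refine ⟨fun {K} => ⟨fun {c} hc => ?_⟩⟩
  let M : J → DGModule A := fun j => (K.obj ⟨j⟩).as.obj
  let X : DGModule A := c.pt.as.obj
  let ι : ∀ j, (quasiIso A).Q.obj (M j) ⟶ (quasiIso A).Q.obj X := fun j => c.ι.app ⟨j⟩
  let c' : Cocone K :=
    { pt := (quasiIso A).Q.obj (directSum M)
      ι := Discrete.natTrans fun j => (quasiIso A).Q.map (directSumIncl M j.as) }
  let S : (quasiIso A).Q.obj X ⟶ (quasiIso A).Q.obj (directSum M) := hc.desc c'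
  have hS : ∀ j, ι j ≫ S = (quasiIso A).Q.map (directSumIncl M j) := fun j => hc.fac c' ⟨j⟩
  obtain ⟨T, hT⟩ := exists_directSum_desc_derivedCat ι
  -- The coproduct `X` is a retract of the direct sum, by uniqueness of morphisms out of `X`.
  have hST : S ≫ T = 𝟙 _ := hc.hom_ext fun ⟨j⟩ => by
    change ι j ≫ S ≫ T = ι j ≫ 𝟙 _
    rw [← Category.assoc, hS, hT, Category.comp_id]
  refine nonempty_isColimit_preadditiveCoyoneda c ?_ ?_
  · intro s (a : ∀ j, (quasiIso A).Q.obj G ⟶ (quasiIso A).Q.obj (M j))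
      (h : ∑ j ∈ s, a j ≫ ι j = 0) l hl
    -- Moving the relation to the direct sum and projecting to the summand `l` isolates `a l`.
    have h1 := congrArg (fun f => (f ≫ S) ≫ (quasiIso A).Q.map (directSumProj M l)) h
    simp only [Preadditive.sum_comp, Category.assoc, zero_comp, reassoc_of% hS,
      ← Functor.map_comp] at h1
    rw [Finset.sum_eq_single l, directSumIncl_proj_self, CategoryTheory.Functor.map_id] at h1
    · exact (Category.comp_id _).symm.trans h1
    · intro j _ hj
      rw [directSumIncl_proj_ne M hj, Functor.map_zero, comp_zero]
    · exact fun h => (h hl).elim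
  · intro (f : (quasiIso A).Q.obj G ⟶ (quasiIso A).Q.obj X)
    -- Composed with `S`, the morphism `f` is represented by an actual `g`, which meets finitely
    -- many summands; the retraction `T` brings this finite sum back to `X`.
    obtain ⟨g, hg⟩ := Q_map_surjective_of_lift hG (f ≫ S)
    obtain ⟨s, hs⟩ := eq_sum_of_finite hE hspan g
    refine ⟨s, fun j => (quasiIso A).Q.map (g ≫ directSumProj M j), ?_⟩
    have h1 : (quasiIso A).Q.map g = ∑ j ∈ s,
        (quasiIso A).Q.map (g ≫ directSumProj M j ≫ directSumIncl M j) :=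
      (congrArg (quasiIso A).Q.map hs).trans ((quasiIso A).Q.map_sum _ _)
    have h2 : f = (quasiIso A).Q.map g ≫ T := by
      rw [hg, Category.assoc, hST, Category.comp_id]
    rw [h2, h1, Preadditive.sum_comp]
    refine Finset.sum_congr rfl fun j _ => ?_
    rw [← Category.assoc, Functor.map_comp, Category.assoc, hT]
    rfl

end DGModule

end DG

theorem proposition4p1 {k : Type u} [Field k] (A : DGAlgebra k) (hA : A.IsConnected)
    (hN : IsNoetherianRing A.Cohomology) (G : DGModule A) (hsf : G.IsSemiFree)
    (hmin : G.IsMinimal) (hcl : G.dgFreeClass < ⊤) (hfg : G.IsCohomologicallyFinite) :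
    (∃ E : Set G.carrier, E.Finite ∧ G.IsSemiBasis E) ∧ G.IsCompact := by
  obtain ⟨F, hF, n, hn⟩ := DGModule.exists_filtration_of_dgFreeClass_lt_top hcl
  obtain ⟨ι, b, hb, hFb, hd⟩ := hF.exists_basis
  have hfin := DGModule.finite_basis_step hA hN hmin hfg hF b hFb hd
  have hd' : ∀ p, G.d (b p) ∈ Submodule.span A.carrier (b '' {q | q.1 < p.1}) :=
    fun p => hFb p.1 ▸ hd p
  rw [hFb] at hn
  have hE := DGModule.finite_semiBasis_of_basis hA b hb hd' hn
  exact ⟨⟨_, hE⟩, DGModule.isCompact_of_lift hE.1 hE.2.span_eq_top fun N P π hπ hs f =>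
    DGModule.exists_lift_of_basis b hb hd' hn hπ hs f⟩
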